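/- For a finite group $G$, let $\mathrm{Irr}(G)$ be the set of complex irreducible characters of $G$, let $\mathbf Z(G)$ be its centre, and let $G^{(\infty)}$ be the last term of its derived series. For $N\trianglelefteq G$ and $\theta\in\mathrm{Irr}(N)$, let $\mathrm{Irr}(G\mid\theta)$ be the set of $\chi\in\mathrm{Irr}(G)$ such that $\theta$ is a constituent of the restriction $\chi_N$. Write $o(x)$ for the order of a group element $x$. Consider the following conjecture on nearly simple groups: (C) Let $G$ be a finite group such that $S\trianglelefteq G/\mathbf Z(G)\le\mathrm{Aut}(S)$ for some non-abelian simple group $S$ (where $S$ is identified with $\mathrm{Inn}(S)$), and let $\chi\in\mathrm{Irr}(G)$ be faithful. Suppose that the restriction of $\chi$ to $G^{(\infty)}$ is irreducible, and that $g\in G$ satisfies $\chi(g)\ne0$ and $G=\langle G^{(\infty)},\mathbf Z(G),g\rangle$. Then $o(g\mathbf Z(G))$ divides $|G:\mathbf Z(G)|/\chi(1)$. Theorem. Assume that (C) holds (for all such $G$, $\chi$, $g$). Let $G$ be a finite group, $N\trianglelefteq G$, $\theta\in\mathrm{Irr}(N)$, $\chi\in\mathrm{Irr}(G\mid\theta)$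 and $g\in G$. If $\chi(gn)\ne0$ for some $n\in N$, then $$o(gN)\quad\text{divides}\quad\frac{|G:N|\,\theta(1)}{\chi(1)}.$$ In particular, the number on the right is an integer. -/

import Mathlib

/-- `χ ∈ Irr(G)`: the function `χ : G → ℂ` is the character of an irreducible
finite-dimensional complex representation of `G`. -/
def IsIrrChar {G : Type*} [Group G] (χ : G → ℂ) : Prop :=
  ∃ (d : ℕ) (ρ : Representation ℂ G (Fin d → ℂ)), ρ.IsIrreducible ∧ χ = ρ.character

/-- The usual Hermitian product `[α, β] = |G|⁻¹ ∑_g α(g) conj(β(g))` of complex functions on a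
finite group. -/
noncomputable def charInner {G : Type*} (α β : G → ℂ) : ℂ :=
  (Nat.card G : ℂ)⁻¹ * ∑ᶠ g : G, α g * (starRingEnd ℂ) (β g)

/-- `χ ∈ Irr(G | θ)`: `χ` is an irreducible character of `G` and `θ` is a constituent of the
restriction of `χ` to the subgroup `N` (where `θ ∈ Irr(N)`). -/
def IsIrrCharOver {G : Type*} [Group G] {N : Subgroup G} (θ : N → ℂ) (χ : G → ℂ) : Prop :=
  IsIrrChar χ ∧ charInner (fun n : N => χ n) θ ≠ 0

/-- A character is faithful if its kernel `{g | χ g = χ 1}` is trivial. -/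
def IsFaithfulChar {G : Type*} [Group G] (χ : G → ℂ) : Prop :=
  ∀ g : G, χ g = χ 1 → g = 1

/-- `G^(∞)`, the intersection (for finite `G`: the last term) of the derived series of `G`. -/
def solvableResidual (G : Type*) [Group G] : Subgroup G :=
  ⨅ n : ℕ, derivedSeries G n

/-- `S ⊴ X ≤ Aut(S)` for some non-abelian simple group `S`: the group `X` embeds in `Aut(S)`
with image containing the group `Inn(S) ≅ S` of inner automorphisms. -/
def IsAlmostSimple (X : Type) [Group X] : Prop :=
  ∃ (S : Type) (_ : Group S), IsSimpleGroup S ∧ (∃ a b : S, a * b ≠ b * a) ∧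
    ∃ f : X →* MulAut S, Function.Injective f ∧ (MulAut.conj (G := S)).range ≤ f.range

/-- The conjecture on nearly simple groups. For a finite group `G` with `G/Z(G)` almost simple,
a faithful irreducible character `χ` of `G` whose restriction to `G^(∞)` is irreducible, and
`g : G` with `χ g ≠ 0` and `G = ⟨G^(∞), Z(G), g⟩`, the order of `g Z(G)` divides
`|G : Z(G)| / χ(1)`; that is, this complex number is an integer multiple of that order.
(Every finite group is isomorphic to one in `Type`.) -/
def NearlySimpleConjecture : Prop :=
  ∀ (G : Type) [Group G] [Finite G], IsAlmostSimple (G ⧸ Subgroup.center G) →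
    ∀ χ : G → ℂ, IsIrrChar χ → IsFaithfulChar χ →
      IsIrrChar (fun x : solvableResidual G => χ x) →
      ∀ g : G, χ g ≠ 0 →
        solvableResidual G ⊔ Subgroup.center G ⊔ Subgroup.zpowers g = ⊤ →
        ∃ k : ℤ, ((Subgroup.center G).index : ℂ) / χ 1 =
          (orderOf (g : G ⧸ Subgroup.center G) : ℂ) * k

/-!
The statement is a special case of one about projective representations. If `X` is an irreducible
projective representation of a finite group `Q` and `X g` has nonzero trace, then
`orderOf g * dim X` divides `|Q|` (`OrderMulDegreeDvd`,
`NearlySimpleConjecture.orderMulDegreeDvd`). Projective representations are the class in which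
Clifford theory stays: if `U` is a simple `M`-subspace of `X` for a normal subgroup `M`, then
`X` is induced from `b ⊗ a`, where `a` extends the action on `U` to the stabilizer `T` of an
isotypic component and `b` is a projective representation of `T / M` (`IsProjRep.clifford`); if
`X g` has nonzero trace, then so do `b` and `a` at some conjugate of `g` in `T`. For `M = N` and
`U` affording `θ`, the assertion on `χ` is the one on `b`, since `χ 1 / θ 1 = |Q : T| * dim b`.

The projective statement is proved by induction on `|Q|`. Elements acting by scalars can be
factored out, so `X` may be assumed faithful. Clifford theory for a minimal normal subgroup `M`,
the inductive assumption for `b` on `T / M`, and the equality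
`|⟨M, g⟩| = orderOf (g : Q ⧸ M) * |M|` leave the case where `X` is irreducible on `M` and
`Q = ⟨M, g⟩`.

* If `M` is abelian, it has order `d ^ 2` and exponent dividing `d`, where `d = dim X`
  (`card_eq_sq_of_abelian`), and the assertion follows.
* If `M` is a non-abelian simple group, the operators of determinant one that are proportional to
  some `X q` form a finite central extension of `Q` to which the conjecture on nearly simple groups
  applies (`NearlySimpleConjecture.orderOf_mul_finrank_dvd`).
* Otherwise `M` is a product of conjugates of a simple group `K` that is not normal in `Q`
  (`orderOf_mul_finrank_dvd_of_not_normal`). If `T` is the normalizer of `K` and `s = |Q : T|`, then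
  `X` restricted to `T` is a tensor product of two factors, one a projective representation of
  `T` modulo the centralizer of `K`, the other irreducible on that centralizer. The first factor has
  nonzero trace at `g ^ s`: for `k` in `K` the element `g` is conjugate to
  `k * g ^ s * k⁻¹ * (g ^ s)⁻¹ * g` (`exists_conj_eq_of_commute`), so that otherwise averaging over
  `K` would give trace zero at `g` (`trace_eq_zero_of_sum_conj_eq_zero`). The inductive assumption
  for the first factor at `g ^ s`, and for the second at the identity, gives the assertion.
-/

open Module
open scoped TensorProduct commutatorElement

/-! ### Projective representations -/

/-- A projective representation of `Q` on `V`, given by a lift `X` to linear operators: `X` is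
multiplicative up to nonzero scalars. -/
structure IsProjRep {Q V : Type*} [Group Q] [AddCommGroup V] [Module ℂ V]
    (X : Q → Module.End ℂ V) : Prop where
  one : ∃ c : ℂ, c ≠ 0 ∧ X 1 = c • 1
  mul : ∀ g h, ∃ c : ℂ, c ≠ 0 ∧ X (g * h) = c • (X g * X h)

/-- A family of operators acts irreducibly on `V`: the space is nonzero and has no proper nonzero
subspace stable under the whole family. -/
structure ActsIrred {ι V : Type*} [AddCommGroup V] [Module ℂ V] (X : ι → Module.End ℂ V) :
    Prop where
  nontrivial : Nontrivial V
  eq_bot_or_eq_top : ∀ W : Submodule ℂ V, (∀ i, ∀ w ∈ W, X i w ∈ W) → W = ⊥ ∨ W = ⊤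

namespace ActsIrred

variable {ι V : Type*} [AddCommGroup V] [Module ℂ V] {X : ι → Module.End ℂ V}

/-- Schur's lemma: an operator commuting with an irreducible family is a scalar. -/
theorem schur [FiniteDimensional ℂ V] (hX : ActsIrred X) {T : Module.End ℂ V}
    (hT : ∀ i, T * X i = X i * T) : ∃ c : ℂ, T = c • 1 := by
  have := hX.nontrivial
  obtain ⟨c, hc⟩ := Module.End.exists_eigenvalue T
  refine ⟨c, ?_⟩
  have key : End.eigenspace T c = ⊤ := by
    refine (hX.eq_bot_or_eq_top _ ?_).resolve_left hc
    intro i w hw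
    rw [End.mem_eigenspace_iff] at hw ⊢
    rw [← Module.End.mul_apply, hT, Module.End.mul_apply, hw, map_smul]
  ext v
  have : v ∈ End.eigenspace T c := key ▸ Submodule.mem_top
  simpa using End.mem_eigenspace_iff.1 this

/-- Irreducibility passes to a family whose invariant subspaces are invariant under the given
family. -/
theorem of_forall_invariant (hX : ActsIrred X) {κ : Type*} {Y : κ → Module.End ℂ V}
    (h : ∀ W : Submodule ℂ V, (∀ k, ∀ w ∈ W, Y k w ∈ W) → ∀ i, ∀ w ∈ W, X i w ∈ W) :
    ActsIrred Y :=
  ⟨hX.nontrivial, fun W hW => hX.eq_bot_or_eq_top W (h W hW)⟩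

end ActsIrred

namespace IsProjRep

variable {Q V : Type*} [Group Q] [AddCommGroup V] [Module ℂ V] {X : Q → Module.End ℂ V}

theorem exists_unit (hX : IsProjRep X) (g : Q) :
    ∃ u : (Module.End ℂ V)ˣ, (u : Module.End ℂ V) = X g ∧
      ∃ c : ℂ, ((u⁻¹ : (Module.End ℂ V)ˣ) : Module.End ℂ V) = c • X g⁻¹ := by
  obtain ⟨a, ha, h1⟩ := hX.one
  obtain ⟨b, hb, h2⟩ := hX.mul g g⁻¹
  obtain ⟨c, hc, h3⟩ := hX.mul g⁻¹ g
  rw [mul_inv_cancel, h1] at h2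
  rw [inv_mul_cancel, h1] at h3
  have e2 : X g * X g⁻¹ = (b⁻¹ * a) • 1 := by rw [mul_smul, h2, inv_smul_smul₀ hb]
  have e3 : X g⁻¹ * X g = (c⁻¹ * a) • 1 := by rw [mul_smul, h3, inv_smul_smul₀ hc]
  have key : b⁻¹ * a = c⁻¹ * a ∨ Subsingleton V := by
    by_cases hs : Subsingleton V
    · exact Or.inr hs
    · rw [not_subsingleton_iff_nontrivial] at hs
      left
      have h4 : X g * (X g⁻¹ * X g) = (X g * X g⁻¹) * X g := by rw [mul_assoc]
      rw [e2, e3, mul_smul_comm, smul_mul_assoc, mul_one, one_mul] at h4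
      have hne : X g ≠ 0 := by
        intro h0
        rw [h0, zero_mul] at e2
        exact smul_ne_zero (mul_ne_zero (inv_ne_zero hb) ha) one_ne_zero e2.symm
      exact (smul_left_injective ℂ hne h4).symm
  rcases key with key | hs
  · refine ⟨⟨X g, (b⁻¹ * a)⁻¹ • X g⁻¹, ?_, ?_⟩, rfl, _, rfl⟩
    · rw [mul_smul_comm, e2, inv_smul_smul₀ (mul_ne_zero (inv_ne_zero hb) ha)]
    · rw [smul_mul_assoc, e3, key, inv_smul_smul₀ (mul_ne_zero (inv_ne_zero hc) ha)]
  · exact ⟨⟨X g, X g⁻¹, Subsingleton.elim _ _, Subsingleton.elim _ _⟩, rfl, 1,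
      Subsingleton.elim _ _⟩

/-- The operator `X g` as a unit of the endomorphism algebra. -/
noncomputable def unit (hX : IsProjRep X) (g : Q) : (Module.End ℂ V)ˣ :=
  (hX.exists_unit g).choose

@[simp] theorem unit_val (hX : IsProjRep X) (g : Q) : (hX.unit g : Module.End ℂ V) = X g :=
  (hX.exists_unit g).choose_spec.1

theorem unit_inv (hX : IsProjRep X) (g : Q) :
    ∃ c : ℂ, (((hX.unit g)⁻¹ : (Module.End ℂ V)ˣ) : Module.End ℂ V) = c • X g⁻¹ :=
  (hX.exists_unit g).choose_spec.2

theorem inv_mul_self (hX : IsProjRep X) (g : Q) :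
    (((hX.unit g)⁻¹ : (Module.End ℂ V)ˣ) : Module.End ℂ V) * X g = 1 := by
  rw [← (hX.unit g).inv_mul, unit_val]

theorem mul_inv_self (hX : IsProjRep X) (g : Q) :
    X g * (((hX.unit g)⁻¹ : (Module.End ℂ V)ˣ) : Module.End ℂ V) = 1 := by
  rw [← (hX.unit g).mul_inv, unit_val]

theorem injective (hX : IsProjRep X) (g : Q) : Function.Injective (X g) := by
  have := (Module.End.isUnit_iff _).1 ((hX.unit g).isUnit)
  rw [unit_val] at this
  exact this.1

theorem ne_zero [Nontrivial V] (hX : IsProjRep X) (g : Q) : X g ≠ 0 := by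
  rw [← hX.unit_val g]
  exact Units.ne_zero _

/-- Pulling a projective representation back along a group homomorphism. -/
theorem comp {H : Type*} [Group H] (hX : IsProjRep X) (f : H →* Q) :
    IsProjRep (fun h => X (f h)) :=
  ⟨by simpa using hX.one, fun g h => by simpa using hX.mul (f g) (f h)⟩

theorem subgroup (hX : IsProjRep X) (H : Subgroup Q) : IsProjRep (fun h : H => X h) :=
  hX.comp H.subtype

/-- The restriction to an invariant subspace. -/
theorem restrict (hX : IsProjRep X) {W : Submodule ℂ V} (hW : ∀ g, ∀ w ∈ W, X g w ∈ W) :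
    IsProjRep (fun g => (X g).restrict (hW g)) := by
  refine ⟨?_, fun g h => ?_⟩
  · obtain ⟨c, hc, h⟩ := hX.one
    exact ⟨c, hc, by ext w; simp [h]⟩
  · obtain ⟨c, hc, h'⟩ := hX.mul g h
    exact ⟨c, hc, by ext w; simp [h']⟩

/-- Conjugation of operators by `X g`. -/
noncomputable def conj (hX : IsProjRep X) (g : Q) : Module.End ℂ V →ₗ[ℂ] Module.End ℂ V :=
  LinearMap.mulLeft ℂ (X g) ∘ₗ LinearMap.mulRight ℂ (((hX.unit g)⁻¹ : (Module.End ℂ V)ˣ) :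
    Module.End ℂ V)

theorem conj_apply (hX : IsProjRep X) (g : Q) (T : Module.End ℂ V) :
    hX.conj g T = X g * (T * (((hX.unit g)⁻¹ : (Module.End ℂ V)ˣ) : Module.End ℂ V)) := rfl

theorem conj_mul_self (hX : IsProjRep X) (g : Q) (T : Module.End ℂ V) :
    hX.conj g T * X g = X g * T := by
  rw [conj_apply, mul_assoc, mul_assoc, inv_mul_self, mul_one]

theorem eq_conj_iff (hX : IsProjRep X) {g : Q} {S T : Module.End ℂ V} :
    S = hX.conj g T ↔ S * X g = X g * T := by
  refine ⟨fun h => h ▸ hX.conj_mul_self g T, fun h => ?_⟩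
  have := h.trans (hX.conj_mul_self g T).symm
  rw [← hX.unit_val g] at this
  exact (Units.mul_left_inj _).1 this

theorem conj_mul (hX : IsProjRep X) (g h : Q) (T : Module.End ℂ V) :
    hX.conj (g * h) T = hX.conj g (hX.conj h T) := by
  symm
  rw [eq_conj_iff]
  obtain ⟨c, -, e⟩ := hX.mul g h
  rw [e, mul_smul_comm, smul_mul_assoc, ← mul_assoc, conj_mul_self, mul_assoc, conj_mul_self,
    mul_assoc]

theorem conj_one (hX : IsProjRep X) (T : Module.End ℂ V) : hX.conj 1 T = T := by
  symm
  rw [eq_conj_iff]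
  obtain ⟨c, -, e⟩ := hX.one
  rw [e, mul_smul_comm, smul_mul_assoc, one_mul, mul_one]

theorem conj_eq_self_iff (hX : IsProjRep X) {g : Q} {T : Module.End ℂ V} :
    hX.conj g T = T ↔ T * X g = X g * T := by
  rw [eq_comm, eq_conj_iff]

theorem conj_apply_mul (hX : IsProjRep X) (g : Q) (S T : Module.End ℂ V) :
    hX.conj g (S * T) = hX.conj g S * hX.conj g T := by
  symm
  rw [eq_conj_iff, mul_assoc, conj_mul_self, ← mul_assoc, conj_mul_self, mul_assoc]

theorem conj_apply_self (hX : IsProjRep X) (g h : Q) :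
    ∃ c : ℂ, c ≠ 0 ∧ hX.conj g (X h) = c • X (g * h * g⁻¹) := by
  obtain ⟨c, hc, e⟩ := hX.mul g h
  obtain ⟨d, hd, e'⟩ := hX.mul (g * h * g⁻¹) g
  rw [inv_mul_cancel_right] at e'
  refine ⟨c⁻¹ * d, mul_ne_zero (inv_ne_zero hc) hd, ?_⟩
  symm
  rw [eq_conj_iff, smul_mul_assoc, mul_smul, ← e', e, inv_smul_smul₀ hc]

theorem trace_conj (hX : IsProjRep X) (g : Q) (T : Module.End ℂ V) :
    LinearMap.trace ℂ V (hX.conj g T) = LinearMap.trace ℂ V T := by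
  rw [conj_apply, ← mul_assoc, ← hX.unit_val g, LinearMap.trace_conj]

/-- The sum of all conjugates of an operator. -/
noncomputable def avg [Fintype Q] (hX : IsProjRep X) (T : Module.End ℂ V) : Module.End ℂ V :=
  ∑ g, hX.conj g T

theorem avg_comm [Fintype Q] (hX : IsProjRep X) (T : Module.End ℂ V) (g : Q) :
    hX.avg T * X g = X g * hX.avg T := by
  rw [← hX.conj_eq_self_iff, avg, map_sum]
  exact Fintype.sum_equiv (Equiv.mulLeft g) _ _ (fun x => (hX.conj_mul g x T).symm)

theorem trace_avg [Fintype Q] (hX : IsProjRep X) (T : Module.End ℂ V) :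
    LinearMap.trace ℂ V (hX.avg T) = Fintype.card Q * LinearMap.trace ℂ V T := by
  rw [avg, map_sum]
  simp [trace_conj]

/-- By Schur's lemma the sum of the conjugates of an operator under an irreducible projective
representation is a scalar, found by comparing traces. -/
theorem avg_eq [Fintype Q] [FiniteDimensional ℂ V] (hX : IsProjRep X) (hirr : ActsIrred X)
    (T : Module.End ℂ V) :
    hX.avg T = (Fintype.card Q * LinearMap.trace ℂ V T / finrank ℂ V : ℂ) • 1 := by
  have := hirr.nontrivial
  obtain ⟨c, hc⟩ := hirr.schur (hX.avg_comm T)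
  have h := hX.trace_avg T
  rw [hc, map_smul, LinearMap.trace_one, smul_eq_mul] at h
  have hd : (finrank ℂ V : ℂ) ≠ 0 := by
    exact_mod_cast (finrank_pos (R := ℂ) (M := V)).ne'
  rw [hc, ← h, mul_div_cancel_right₀ _ hd]

/-- Maschke's theorem: an invariant subspace is the image of a projection that commutes with the
projective representation. -/
theorem exists_projection [Finite Q] (hX : IsProjRep X) {W : Submodule ℂ V}
    (hW : ∀ g, ∀ w ∈ W, X g w ∈ W) :
    ∃ p : Module.End ℂ V, (∀ g, p * X g = X g * p) ∧ (∀ v, p v ∈ W) ∧ ∀ w ∈ W, p w = w := by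
  have := Fintype.ofFinite Q
  obtain ⟨q, hq⟩ := W.subtype.exists_leftInverse_of_injective (Submodule.ker_subtype W)
  have hq' : ∀ w (hw : w ∈ W), q w = ⟨w, hw⟩ := fun w hw => by
    have := LinearMap.congr_fun hq ⟨w, hw⟩
    simpa using this
  set T : Module.End ℂ V := W.subtype ∘ₗ q with hT
  have hinv : ∀ g, ∀ w ∈ W, (((hX.unit g)⁻¹ : (Module.End ℂ V)ˣ) : Module.End ℂ V) w ∈ W := by
    intro g w hw
    obtain ⟨c, e⟩ := hX.unit_inv g
    rw [e]
    exact W.smul_mem _ (hW _ _ hw)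
  have hc : (Fintype.card Q : ℂ) ≠ 0 := by exact_mod_cast Fintype.card_ne_zero
  refine ⟨(Fintype.card Q : ℂ)⁻¹ • hX.avg T, fun g => ?_, fun v => ?_, fun w hw => ?_⟩
  · rw [smul_mul_assoc, avg_comm, mul_smul_comm]
  · rw [LinearMap.smul_apply, avg, LinearMap.sum_apply]
    refine W.smul_mem _ (W.sum_mem fun g _ => ?_)
    exact hW _ _ (q _).2
  · rw [LinearMap.smul_apply, avg, LinearMap.sum_apply]
    have : ∀ g ∈ Finset.univ, hX.conj g T w = w := by
      intro g _
      rw [conj_apply, Module.End.mul_apply, Module.End.mul_apply, hT, LinearMap.comp_apply,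
        hq' _ (hinv g w hw), Submodule.subtype_apply, ← Module.End.mul_apply, mul_inv_self,
        Module.End.one_apply]
    rw [Finset.sum_congr rfl this, Finset.sum_const, Finset.card_univ, ← Nat.cast_smul_eq_nsmul ℂ,
      inv_smul_smul₀ hc]

/-- The rank-one operators are explicit combinations of the operators of an irreducible projective
representation. -/
theorem sum_smul_eq [Fintype Q] [FiniteDimensional ℂ V] (hX : IsProjRep X) (hirr : ActsIrred X)
    (φ : V →ₗ[ℂ] ℂ) (u : V) :
    ∑ g, φ ((((hX.unit g)⁻¹ : (Module.End ℂ V)ˣ) : Module.End ℂ V) u) • X g =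
      (Fintype.card Q / finrank ℂ V : ℂ) • φ.smulRight u := by
  ext w
  have h := LinearMap.congr_fun (hX.avg_eq hirr (φ.smulRight w)) u
  rw [avg, LinearMap.sum_apply, LinearMap.trace_smulRight] at h
  simp only [conj_apply, Module.End.mul_apply, LinearMap.smulRight_apply, map_smul,
    LinearMap.smul_apply, Module.End.one_apply] at h
  simp only [LinearMap.sum_apply, LinearMap.smul_apply, LinearMap.smulRight_apply]
  rw [h, smul_smul]
  congr 1
  ring

end IsProjRep

/-! ### Tensor decompositions -/

/-- The space of operators `U → V` that intertwine two families of endomorphisms. -/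
def homSpace {ι U V : Type*} [AddCommGroup U] [Module ℂ U] [AddCommGroup V] [Module ℂ V]
    (σ : ι → Module.End ℂ U) (X : ι → Module.End ℂ V) : Submodule ℂ (U →ₗ[ℂ] V) where
  carrier := {f | ∀ i, f ∘ₗ σ i = X i ∘ₗ f}
  add_mem' {f g} hf hg i := by rw [LinearMap.add_comp, LinearMap.comp_add, hf i, hg i]
  zero_mem' i := by rw [LinearMap.zero_comp, LinearMap.comp_zero]
  smul_mem' c f hf i := by rw [LinearMap.smul_comp, LinearMap.comp_smul, hf i]

theorem mem_homSpace {ι U V : Type*} [AddCommGroup U] [Module ℂ U] [AddCommGroup V] [Module ℂ V]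
    {σ : ι → Module.End ℂ U} {X : ι → Module.End ℂ V} {f : U →ₗ[ℂ] V} :
    f ∈ homSpace σ X ↔ ∀ i u, f (σ i u) = X i (f u) :=
  ⟨fun h i u => LinearMap.congr_fun (h i) u, fun h i => LinearMap.ext (h i)⟩

section contraction

variable {Y U : Type*} [AddCommGroup Y] [Module ℂ Y] [AddCommGroup U] [Module ℂ U]

/-- Contraction of the second tensor factor with a functional. -/
noncomputable def tensorContractRight (φ : U →ₗ[ℂ] ℂ) : Y ⊗[ℂ] U →ₗ[ℂ] Y :=
  (TensorProduct.rid ℂ Y).toLinearMap ∘ₗ φ.lTensor Y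

/-- Contraction of the first tensor factor with a functional. -/
noncomputable def tensorContractLeft (φ : Y →ₗ[ℂ] ℂ) : Y ⊗[ℂ] U →ₗ[ℂ] U :=
  (TensorProduct.lid ℂ U).toLinearMap ∘ₗ φ.rTensor U

@[simp] theorem tensorContractRight_tmul (φ : U →ₗ[ℂ] ℂ) (y : Y) (u : U) :
    tensorContractRight φ (y ⊗ₜ[ℂ] u) = φ u • y := by simp [tensorContractRight]

@[simp] theorem tensorContractLeft_tmul (φ : Y →ₗ[ℂ] ℂ) (y : Y) (u : U) :
    tensorContractLeft φ (y ⊗ₜ[ℂ] u) = φ y • u := by simp [tensorContractLeft]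

theorem lTensor_smulRight (φ : U →ₗ[ℂ] ℂ) (u : U) (z : Y ⊗[ℂ] U) :
    (φ.smulRight u).lTensor Y z = tensorContractRight φ z ⊗ₜ[ℂ] u := by
  induction z with
  | zero => simp
  | tmul y w => simp [TensorProduct.smul_tmul]
  | add z w hz hw => rw [map_add, hz, hw, map_add, TensorProduct.add_tmul]

theorem eq_zero_of_contractRight [FiniteDimensional ℂ U] {z : Y ⊗[ℂ] U}
    (h : ∀ φ : U →ₗ[ℂ] ℂ, tensorContractRight φ z = 0) : z = 0 := by
  let e := Module.finBasis ℂ U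
  have h1 : ∑ i, (e.coord i).smulRight (e i) = (LinearMap.id : U →ₗ[ℂ] U) := by
    ext u
    simp
  have h2 : (LinearMap.id : U →ₗ[ℂ] U).lTensor Y z = z := by simp
  rw [← h2, ← h1, ← LinearMap.coe_lTensorHom, map_sum, LinearMap.sum_apply]
  refine Finset.sum_eq_zero fun i _ => ?_
  rw [LinearMap.coe_lTensorHom, lTensor_smulRight, h, TensorProduct.zero_tmul]

theorem eq_zero_of_contractLeft [FiniteDimensional ℂ Y] {z : Y ⊗[ℂ] U}
    (h : ∀ φ : Y →ₗ[ℂ] ℂ, tensorContractLeft φ z = 0) : z = 0 := by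
  refine (TensorProduct.comm ℂ Y U).map_eq_zero_iff.1 (eq_zero_of_contractRight fun φ => ?_)
  rw [← h φ]
  clear h
  induction z with
  | zero => simp
  | tmul y w => simp
  | add z w hz hw => rw [map_add, map_add, hz, hw, map_add]

end contraction

section prop

variable {Y U : Type*} [AddCommGroup Y] [Module ℂ Y] [AddCommGroup U] [Module ℂ U]

theorem exists_functional_eq_one {V : Type*} [AddCommGroup V] [Module ℂ V] {v : V} (hv : v ≠ 0) :
    ∃ φ : V →ₗ[ℂ] ℂ, φ v = 1 := by
  obtain ⟨f, hf⟩ := (LinearMap.toSpanSingleton ℂ V v).exists_leftInverse_of_injective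
    (LinearMap.ker_toSpanSingleton ℂ hv)
  exact ⟨f, by simpa using LinearMap.congr_fun hf 1⟩

/-- The first factor of a nonzero pure tensor of operators is determined up to a scalar. -/
theorem eq_smul_of_tmul_left {b b' : Module.End ℂ Y} {a a' : Module.End ℂ U} (hb : b ≠ 0)
    (ha : a ≠ 0) (h : ∀ y u, b y ⊗ₜ[ℂ] a u = b' y ⊗ₜ[ℂ] a' u) : ∃ d : ℂ, d ≠ 0 ∧ b = d • b' := by
  obtain ⟨u, hu⟩ : ∃ u, a u ≠ 0 := by
    by_contra! hu
    exact ha (LinearMap.ext hu)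
  obtain ⟨φ, hφ⟩ := exists_functional_eq_one hu
  have e : b = φ (a' u) • b' := by
    ext y
    simpa [hφ] using congrArg (tensorContractRight φ) (h y u)
  refine ⟨_, ?_, e⟩
  intro h0
  rw [h0, zero_smul] at e
  exact hb e

/-- The second factor of a nonzero pure tensor of operators is determined up to a scalar. -/
theorem eq_smul_of_tmul_right {b b' : Module.End ℂ Y} {a a' : Module.End ℂ U} (hb : b ≠ 0)
    (ha : a ≠ 0) (h : ∀ y u, b y ⊗ₜ[ℂ] a u = b' y ⊗ₜ[ℂ] a' u) : ∃ d : ℂ, d ≠ 0 ∧ a = d • a' :=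
  eq_smul_of_tmul_left ha hb fun u y => (TensorProduct.comm ℂ Y U).congr_arg (h y u)

end prop

section evaluation

variable {M U V : Type*} [AddCommGroup U] [Module ℂ U] [AddCommGroup V] [Module ℂ V]
  {σ : M → Module.End ℂ U} {X : M → Module.End ℂ V}

/-- The evaluation map `Hom(U, V) ⊗ U → V` on the space of intertwining operators. -/
noncomputable def homEval (σ : M → Module.End ℂ U) (X : M → Module.End ℂ V) :
    homSpace σ X ⊗[ℂ] U →ₗ[ℂ] V :=
  TensorProduct.lift (homSpace σ X).subtype

@[simp] theorem homEval_tmul (f : homSpace σ X) (u : U) :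
    homEval σ X (f ⊗ₜ[ℂ] u) = (f : U →ₗ[ℂ] V) u := rfl

theorem homEval_lTensor (m : M) (z : homSpace σ X ⊗[ℂ] U) :
    homEval σ X ((σ m).lTensor _ z) = X m (homEval σ X z) := by
  induction z with
  | zero => simp
  | tmul f u => simpa using mem_homSpace.1 f.2 m u
  | add z w hz hw => rw [map_add, map_add, hz, hw, map_add, map_add]

/-- By Schur's lemma, evaluation on the space of intertwining operators from an irreducible
projective representation is injective. -/
theorem homEval_injective [Group M] [Finite M] [FiniteDimensional ℂ U] (hσ : IsProjRep σ)
    (hirr : ActsIrred σ) : Function.Injective (homEval σ X) := by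
  have := Fintype.ofFinite M
  have := hirr.nontrivial
  refine (injective_iff_map_eq_zero _).2 fun z hz => ?_
  have h1 : ∀ (φ : U →ₗ[ℂ] ℂ) (u : U), homEval σ X ((φ.smulRight u).lTensor _ z) = 0 := by
    intro φ u
    have hc : (Fintype.card M / finrank ℂ U : ℂ) ≠ 0 := by
      refine div_ne_zero (by exact_mod_cast Fintype.card_ne_zero) ?_
      exact_mod_cast (finrank_pos (R := ℂ) (M := U)).ne'
    have h2 := congrArg (fun T => homEval σ X (LinearMap.lTensor (homSpace σ X) T z))
      (hσ.sum_smul_eq hirr φ u)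
    simp only [← LinearMap.coe_lTensorHom, map_sum, map_smul, LinearMap.sum_apply,
      LinearMap.smul_apply] at h2
    simp only [LinearMap.coe_lTensorHom, homEval_lTensor, hz, map_zero, smul_zero,
      Finset.sum_const_zero] at h2
    exact (smul_eq_zero.1 h2.symm).resolve_left hc
  refine eq_zero_of_contractRight fun φ => ?_
  ext u
  have := h1 φ u
  rwa [lTensor_smulRight, homEval_tmul] at this

end evaluation

/-- `X g` acts on `V ≃ Y ⊗ U` as the pure tensor `b g ⊗ a g`, for every `g`. -/
def IsTensorDecomp {Q Y U V : Type*} [AddCommGroup Y] [Module ℂ Y] [AddCommGroup U] [Module ℂ U]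
    [AddCommGroup V] [Module ℂ V] (X : Q → Module.End ℂ V) (E : Y ⊗[ℂ] U ≃ₗ[ℂ] V)
    (b : Q → Module.End ℂ Y) (a : Q → Module.End ℂ U) : Prop :=
  ∀ g y u, X g (E (y ⊗ₜ[ℂ] u)) = E (b g y ⊗ₜ[ℂ] a g u)

namespace IsTensorDecomp

variable {Q Y U V : Type*} [AddCommGroup Y] [Module ℂ Y] [AddCommGroup U] [Module ℂ U]
    [AddCommGroup V] [Module ℂ V] {X : Q → Module.End ℂ V} {E : Y ⊗[ℂ] U ≃ₗ[ℂ] V}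
    {b : Q → Module.End ℂ Y} {a : Q → Module.End ℂ U}

theorem eq_conj (h : IsTensorDecomp X E b a) (g : Q) :
    X g = E.conj (TensorProduct.map (b g) (a g)) := by
  ext v
  obtain ⟨z, rfl⟩ := E.surjective v
  rw [LinearEquiv.conj_apply_apply, E.symm_apply_apply]
  induction z with
  | zero => simp
  | tmul y u => rw [h, TensorProduct.map_tmul]
  | add z w hz hw => rw [map_add, map_add, hz, hw, map_add, map_add]

theorem trace_eq [FiniteDimensional ℂ Y] [FiniteDimensional ℂ U] (h : IsTensorDecomp X E b a)
    (g : Q) :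
    LinearMap.trace ℂ V (X g) = LinearMap.trace ℂ Y (b g) * LinearMap.trace ℂ U (a g) := by
  rw [h.eq_conj, LinearMap.trace_conj', LinearMap.trace_tensorProduct']

theorem tmul_eq_of_smul (h : IsTensorDecomp X E b a) {g : Q} {b' : Module.End ℂ Y}
    {a' : Module.End ℂ U} (h' : ∀ y u, X g (E (y ⊗ₜ[ℂ] u)) = E (b' y ⊗ₜ[ℂ] a' u)) (y : Y) (u : U) :
    b g y ⊗ₜ[ℂ] a g u = b' y ⊗ₜ[ℂ] a' u :=
  E.injective (by rw [← h, h'])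

theorem left_ne_zero [Nontrivial V] [Group Q] (hX : IsProjRep X) (h : IsTensorDecomp X E b a)
    (g : Q) : b g ≠ 0 := by
  intro h0
  apply hX.ne_zero g
  rw [h.eq_conj, h0, TensorProduct.map_zero_left, map_zero]

theorem right_ne_zero [Nontrivial V] [Group Q] (hX : IsProjRep X) (h : IsTensorDecomp X E b a)
    (g : Q) : a g ≠ 0 := by
  intro h0
  apply hX.ne_zero g
  rw [h.eq_conj, h0, TensorProduct.map_zero_right, map_zero]

theorem isProjRep_left [Nontrivial V] [Group Q] (hX : IsProjRep X) (h : IsTensorDecomp X E b a) :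
    IsProjRep b := by
  refine ⟨?_, fun g g' => ?_⟩
  · obtain ⟨c, -, e⟩ := hX.one
    exact eq_smul_of_tmul_left (h.left_ne_zero hX 1) (h.right_ne_zero hX 1)
      (h.tmul_eq_of_smul (b' := 1) (a' := c • 1) fun y u => by simp [e])
  · obtain ⟨c, -, e⟩ := hX.mul g g'
    exact eq_smul_of_tmul_left (h.left_ne_zero hX _) (h.right_ne_zero hX _)
      (h.tmul_eq_of_smul (b' := b g * b g') (a' := c • (a g * a g'))
        fun y u => by simp [e, h g, h g'])

theorem isProjRep_right [Nontrivial V] [Group Q] (hX : IsProjRep X) (h : IsTensorDecomp X E b a) :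
    IsProjRep a := by
  refine ⟨?_, fun g g' => ?_⟩
  · obtain ⟨c, -, e⟩ := hX.one
    exact eq_smul_of_tmul_right (h.left_ne_zero hX 1) (h.right_ne_zero hX 1)
      (h.tmul_eq_of_smul (b' := c • 1) (a' := 1)
        fun y u => by simp [e, ← TensorProduct.smul_tmul'])
  · obtain ⟨c, -, e⟩ := hX.mul g g'
    exact eq_smul_of_tmul_right (h.left_ne_zero hX _) (h.right_ne_zero hX _)
      (h.tmul_eq_of_smul (b' := c • (b g * b g')) (a' := a g * a g')
        fun y u => by simp [e, h g, h g', ← TensorProduct.smul_tmul'])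

/-- If operators `X (s i)` of a tensor decomposition act irreducibly on the tensor product, then
they act irreducibly on the first factor. -/
theorem actsIrred_left {ι : Type*} {s : ι → Q} (h : IsTensorDecomp X E b a)
    (hX : ActsIrred fun i => X (s i)) : ActsIrred fun i => b (s i) := by
  have := hX.nontrivial
  obtain ⟨v, hv⟩ := exists_ne (0 : V)
  have hY : Nontrivial Y := by
    by_contra hY
    rw [not_nontrivial_iff_subsingleton] at hY
    exact hv (by rw [← E.apply_symm_apply v, Subsingleton.elim (E.symm v) 0, map_zero])
  have hU : Nontrivial U := by
    by_contra hU
    rw [not_nontrivial_iff_subsingleton] at hU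
    exact hv (by rw [← E.apply_symm_apply v, Subsingleton.elim (E.symm v) 0, map_zero])
  refine ⟨hY, fun W hW => ?_⟩
  let L : W ⊗[ℂ] U →ₗ[ℂ] V := E.toLinearMap ∘ₗ W.subtype.rTensor U
  have hL : ∀ z, ∀ i, ∃ z', X (s i) (L z) = L z' := by
    intro z i
    induction z with
    | zero => exact ⟨0, by simp⟩
    | tmul w u =>
      exact ⟨⟨_, hW i w w.2⟩ ⊗ₜ a (s i) u, by simp [L, h (s i)]⟩
    | add z z' hz hz' =>
      obtain ⟨x, hx⟩ := hz
      obtain ⟨x', hx'⟩ := hz'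
      exact ⟨x + x', by rw [map_add, map_add, hx, hx', map_add]⟩
  rcases hX.eq_bot_or_eq_top (LinearMap.range L) (by
    rintro i _ ⟨z, rfl⟩
    obtain ⟨z', e⟩ := hL z i
    exact ⟨z', e.symm⟩) with h0 | h0
  · left
    rw [eq_bot_iff]
    intro w hw
    obtain ⟨u, hu⟩ := exists_ne (0 : U)
    obtain ⟨φ, hφ⟩ := exists_functional_eq_one hu
    have h1 : L (⟨w, hw⟩ ⊗ₜ u) = 0 := by
      rw [LinearMap.range_eq_bot] at h0
      rw [h0, LinearMap.zero_apply]
    have h2 : w ⊗ₜ[ℂ] u = 0 := E.map_eq_zero_iff.1 (by simpa [L] using h1)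
    simpa [hφ] using congrArg (tensorContractRight φ) h2
  · right
    rw [eq_top_iff]
    intro y _
    obtain ⟨u, hu⟩ := exists_ne (0 : U)
    obtain ⟨φ, hφ⟩ := exists_functional_eq_one hu
    obtain ⟨z, hz⟩ : E (y ⊗ₜ u) ∈ LinearMap.range L := h0 ▸ Submodule.mem_top
    have hz' : W.subtype.rTensor U z = y ⊗ₜ u := E.injective hz
    have hmem : tensorContractRight φ (W.subtype.rTensor U z) ∈ W := by
      clear hz hz'
      induction z with
      | zero => simp
      | tmul w u => simpa using W.smul_mem _ w.2
      | add z w hz hw => rw [map_add, map_add]; exact W.add_mem hz hw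
    rw [hz'] at hmem
    simpa [hφ] using hmem

end IsTensorDecomp

/-- If `V` is spanned by the images of intertwining operators from an irreducible projective
representation `σ` of a normal subgroup `M`, then every `X g` splits as a pure tensor with respect
to `Hom_M(U, V) ⊗ U ≃ V`. -/
theorem exists_isTensorDecomp {Q : Type*} [Group Q] {U V : Type} [AddCommGroup U] [Module ℂ U]
    [FiniteDimensional ℂ U] [AddCommGroup V] [Module ℂ V] [FiniteDimensional ℂ V] [Nontrivial V]
    {X : Q → Module.End ℂ V} (hX : IsProjRep X) (M : Subgroup Q) [M.Normal] [Finite M]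
    {σ : M → Module.End ℂ U} (hσ : IsProjRep σ) (hirr : ActsIrred σ)
    (hspan : ⨆ f ∈ homSpace σ (fun m : M => X m), LinearMap.range f = ⊤) :
    ∃ (Y : Type) (_ : AddCommGroup Y) (_ : Module ℂ Y) (_ : FiniteDimensional ℂ Y)
      (E : Y ⊗[ℂ] U ≃ₗ[ℂ] V) (b : Q → Module.End ℂ Y) (a : Q → Module.End ℂ U),
      IsTensorDecomp X E b a ∧ (∀ m : M, ∃ c : ℂ, c ≠ 0 ∧ b m = c • 1) ∧
        ∀ m : M, ∃ c : ℂ, c ≠ 0 ∧ a m = c • σ m := by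
  set Y := homSpace σ (fun m : M => X m) with hY
  have hsurj : Function.Surjective (homEval σ (fun m : M => X m)) := by
    rw [← LinearMap.range_eq_top, eq_top_iff, ← hspan]
    refine iSup₂_le fun f hf => ?_
    rintro _ ⟨u, rfl⟩
    exact ⟨(⟨f, hf⟩ : Y) ⊗ₜ u, rfl⟩
  let E : Y ⊗[ℂ] U ≃ₗ[ℂ] V := LinearEquiv.ofBijective _ ⟨homEval_injective hσ hirr, hsurj⟩
  have hE : ∀ (y : Y) (u : U), E (y ⊗ₜ u) = (y : U →ₗ[ℂ] V) u := fun y u => rfl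
  have hEσ : ∀ (m : M) (v : V), E.symm (X m v) = (σ m).lTensor Y (E.symm v) := by
    intro m v
    rw [LinearEquiv.symm_apply_eq]
    refine Eq.trans ?_ (homEval_lTensor (X := fun m : M => X m) m (E.symm v)).symm
    exact congrArg (X m) (E.apply_symm_apply v).symm
  have hYn : Nontrivial Y := by
    by_contra hY
    rw [not_nontrivial_iff_subsingleton] at hY
    obtain ⟨v, hv⟩ := exists_ne (0 : V)
    exact hv (by rw [← E.apply_symm_apply v, Subsingleton.elim (E.symm v) 0, map_zero])
  obtain ⟨y₀, hy₀⟩ := exists_ne (0 : Y)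
  obtain ⟨u₀, hu₀⟩ : ∃ u, (y₀ : U →ₗ[ℂ] V) u ≠ 0 := by
    by_contra! hu
    exact hy₀ (Subtype.ext (LinearMap.ext hu))
  have key : ∀ g : Q, ∃ (b : Module.End ℂ Y) (a : Module.End ℂ U),
      ∀ y u, X g (E (y ⊗ₜ u)) = E (b y ⊗ₜ a u) := by
    intro g
    have hcomm : ∀ m : M, ∃ m' : M, ∃ c : ℂ, c ≠ 0 ∧ g⁻¹ * m * g = m' ∧
        ∀ v, X g (X m' v) = c • X m (X g v) := by
      intro m
      refine ⟨⟨g⁻¹ * m * g, by simpa using Subgroup.Normal.conj_mem ‹_› m.1 m.2 g⁻¹⟩, ?_⟩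
      obtain ⟨c, hc, e⟩ := hX.mul g (g⁻¹ * m * g)
      obtain ⟨d, hd, e'⟩ := hX.mul m g
      refine ⟨c⁻¹ * d, mul_ne_zero (inv_ne_zero hc) hd, rfl, fun v => ?_⟩
      rw [show g * (g⁻¹ * m * g) = m * g by group, e'] at e
      have := LinearMap.congr_fun e v
      simp only [LinearMap.smul_apply, Module.End.mul_apply] at this
      rw [mul_smul, this, inv_smul_smul₀ hc]
    obtain ⟨φ, hφ⟩ : ∃ φ : Y →ₗ[ℂ] ℂ,
        tensorContractLeft φ (E.symm (X g ((y₀ : U →ₗ[ℂ] V) u₀))) ≠ 0 := by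
      by_contra! h
      have := eq_zero_of_contractLeft h
      rw [LinearEquiv.map_eq_zero_iff] at this
      exact hu₀ (hX.injective g (by rw [this, map_zero]))
    have hπ : ∀ (m : M) (z : Y ⊗[ℂ] U),
        tensorContractLeft φ ((σ m).lTensor Y z) = σ m (tensorContractLeft φ z) := by
      intro m z
      induction z with
      | zero => simp
      | tmul y u => simp
      | add z w hz hw => rw [map_add, map_add, hz, hw, map_add, map_add]
    let a : Module.End ℂ U :=
      tensorContractLeft φ ∘ₗ E.symm.toLinearMap ∘ₗ X g ∘ₗ (y₀ : U →ₗ[ℂ] V)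
    have ha : ∀ u, a u = tensorContractLeft φ (E.symm (X g ((y₀ : U →ₗ[ℂ] V) u))) := fun u => rfl
    have haσ : ∀ m m' : M, ∀ c : ℂ, (∀ v, X g (X m' v) = c • X m (X g v)) →
        ∀ u, a (σ m' u) = c • σ m (a u) := by
      intro m m' c h u
      rw [ha, mem_homSpace.1 y₀.2 m' u, h, map_smul, map_smul, hEσ, hπ, ← ha]
    have hinj : Function.Injective a := by
      rw [← LinearMap.ker_eq_bot]
      refine (hirr.eq_bot_or_eq_top _ fun m u hu => ?_).resolve_right fun h => ?_
      · obtain ⟨m', c, hc, e, hm⟩ := hcomm (⟨g * m * g⁻¹, Subgroup.Normal.conj_mem ‹_› m.1 m.2 g⟩)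
        have : m' = m := Subtype.ext (by rw [← e]; group)
        subst this
        rw [LinearMap.mem_ker] at hu ⊢
        rw [haσ _ _ c hm, hu, map_zero, smul_zero]
      · apply hφ
        rw [← ha]
        exact LinearMap.mem_ker.1 (h ▸ Submodule.mem_top)
    let e : U ≃ₗ[ℂ] U := LinearEquiv.ofInjectiveEndo a hinj
    have he : ∀ u, e.symm (a u) = u := fun u => e.symm_apply_apply u
    have heσ : ∀ m m' : M, ∀ c : ℂ, (∀ v, X g (X m' v) = c • X m (X g v)) →
        ∀ u, c • e.symm (σ m u) = σ m' (e.symm u) := by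
      intro m m' c h u
      obtain ⟨u, rfl⟩ := e.surjective u
      rw [e.symm_apply_apply, ← map_smul, LinearEquiv.symm_apply_eq]
      exact (haσ m m' c h u).symm
    let b₀ : (U →ₗ[ℂ] V) →ₗ[ℂ] (U →ₗ[ℂ] V) :=
      { toFun := fun f => X g ∘ₗ f ∘ₗ e.symm.toLinearMap
        map_add' := fun f f' => by ext; simp
        map_smul' := fun c f => by ext; simp }
    have hb₀ : ∀ f ∈ Y, b₀ f ∈ Y := by
      intro f hf
      refine mem_homSpace.2 fun m u => ?_
      obtain ⟨m', c, hc, -, hm⟩ := hcomm m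
      have h1 := heσ m m' c hm u
      change X g (f (e.symm (σ m u))) = X m (X g (f (e.symm u)))
      rw [← (smul_right_injective V hc).eq_iff]
      change c • X g (f (e.symm (σ m u))) = c • X m (X g (f (e.symm u)))
      rw [← map_smul, ← map_smul, h1, mem_homSpace.1 hf, hm]
    refine ⟨b₀.restrict hb₀, a, fun y u => ?_⟩
    rw [hE, hE]
    change _ = X g ((y : U →ₗ[ℂ] V) (e.symm (a u)))
    rw [he]
  choose b a hab using key
  have hdec : IsTensorDecomp X E b a := hab
  refine ⟨Y, inferInstance, inferInstance, inferInstance, E, b, a, hdec, fun m => ?_, fun m => ?_⟩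
  · exact eq_smul_of_tmul_left (hdec.left_ne_zero hX m) (hdec.right_ne_zero hX m)
      (hdec.tmul_eq_of_smul (b' := 1) (a' := σ m) fun y u => by
        rw [hE, hE]; exact (mem_homSpace.1 y.2 m u).symm)
  · exact eq_smul_of_tmul_right (hdec.left_ne_zero hX m) (hdec.right_ne_zero hX m)
      (hdec.tmul_eq_of_smul (b' := 1) (a' := σ m) fun y u => by
        rw [hE, hE]; exact (mem_homSpace.1 y.2 m u).symm)

/-! ### Systems of imprimitivity and Clifford theory -/

section imprimitivity

variable {V : Type*} [AddCommGroup V] [Module ℂ V] [FiniteDimensional ℂ V]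

theorem finrank_eq_sum_of_isInternal {ι : Type*} [Fintype ι] [DecidableEq ι]
    {N : ι → Submodule ℂ V} (h : DirectSum.IsInternal N) :
    finrank ℂ V = ∑ i, finrank ℂ (N i) := by
  rw [finrank_eq_card_basis (h.collectedBasis fun i => finBasis ℂ (N i))]
  simp

/-- If an operator of nonzero trace permutes the summands of a direct sum, then it stabilizes some
summand and has nonzero trace on it. -/
theorem exists_trace_restrict_ne_zero {ι : Type*} [Fintype ι] [DecidableEq ι]
    {N : ι → Submodule ℂ V} (h : DirectSum.IsInternal N) {f : Module.End ℂ V}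
    (hf : ∀ i, ∃ j, ∀ v ∈ N i, f v ∈ N j) (htr : LinearMap.trace ℂ V f ≠ 0) :
    ∃ i, ∃ hi : ∀ v ∈ N i, f v ∈ N i, LinearMap.trace ℂ (N i) (f.restrict hi) ≠ 0 := by
  classical
  let v : ∀ i, Basis (Fin (finrank ℂ (N i))) ℂ (N i) := fun i => finBasis ℂ (N i)
  rw [LinearMap.trace_eq_matrix_trace ℂ (h.collectedBasis v), Matrix.trace,
    Fintype.sum_sigma] at htr
  obtain ⟨i, -, hi⟩ := Finset.exists_ne_zero_of_sum_ne_zero htr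
  obtain ⟨j, hj⟩ := hf i
  obtain rfl : j = i := by
    by_contra hij
    refine hi (Finset.sum_eq_zero fun k _ => ?_)
    rw [Matrix.diag_apply, LinearMap.toMatrix_apply, h.collectedBasis_coe]
    exact h.collectedBasis_repr_of_mem_ne v hij (hj _ (v i k).2)
  refine ⟨j, hj, ?_⟩
  rw [LinearMap.trace_eq_matrix_trace ℂ (v j), Matrix.trace]
  convert! hi using 2 with k
  rw [Matrix.diag_apply, Matrix.diag_apply, LinearMap.toMatrix_apply, LinearMap.toMatrix_apply,
    h.collectedBasis_coe]
  exact congrArg (fun w => (v j).repr w k) rfl |>.trans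
    (h.collectedBasis_repr_of_mem v (hj _ (v j k).2)).symm

end imprimitivity

section isotypic

variable {ι V : Type*} [AddCommGroup V] [Module ℂ V]

/-- Subspaces stable under a family of operators and under its commutant. -/
def IsBiInvariant (X : ι → Module.End ℂ V) (W : Submodule ℂ V) : Prop :=
  (∀ i, ∀ w ∈ W, X i w ∈ W) ∧
    ∀ b : Module.End ℂ V, (∀ i, b * X i = X i * b) → ∀ w ∈ W, b w ∈ W

/-- Minimal nonzero subspaces stable under a family of operators and under its commutant. -/
structure IsMinBiInvariant (X : ι → Module.End ℂ V) (W : Submodule ℂ V) : Prop where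
  ne_bot : W ≠ ⊥
  bi : IsBiInvariant X W
  min : ∀ W' ≤ W, IsBiInvariant X W' → W' ≠ ⊥ → W' = W

/-- The isotypic component of `V` generated by `U`: the sum of the images of `U` under the
commutant. -/
def isotypicSpan (X : ι → Module.End ℂ V) (U : Submodule ℂ V) : Submodule ℂ V :=
  ⨆ b : {b : Module.End ℂ V // ∀ i, b * X i = X i * b}, U.map b.1

variable {X : ι → Module.End ℂ V} {U : Submodule ℂ V}

theorem le_isotypicSpan : U ≤ isotypicSpan X U := by
  intro u hu
  exact le_iSup (fun b : {b : Module.End ℂ V // ∀ i, b * X i = X i * b} => U.map b.1)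
    ⟨1, fun i => by simp⟩ ⟨u, hu, rfl⟩

theorem isBiInvariant_isotypicSpan (hU : ∀ i, ∀ u ∈ U, X i u ∈ U) :
    IsBiInvariant X (isotypicSpan X U) := by
  refine ⟨fun i => ?_, fun b hb => ?_⟩
  · change isotypicSpan X U ≤ (isotypicSpan X U).comap (X i)
    refine iSup_le ?_
    rintro b _ ⟨u, hu, rfl⟩
    refine le_iSup (fun b : {b : Module.End ℂ V // ∀ i, b * X i = X i * b} => U.map b.1) b
      ⟨X i u, hU i u hu, ?_⟩
    exact LinearMap.congr_fun (b.2 i) u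
  · change isotypicSpan X U ≤ (isotypicSpan X U).comap b
    refine iSup_le ?_
    rintro b' _ ⟨u, hu, rfl⟩
    exact le_iSup (fun b : {b : Module.End ℂ V // ∀ i, b * X i = X i * b} => U.map b.1)
      ⟨b * b'.1, fun i => by rw [mul_assoc, b'.2, ← mul_assoc, hb, mul_assoc]⟩ ⟨u, hu, rfl⟩

variable {M : Type*} [Group M] [Finite M] {X : M → Module.End ℂ V}

theorem isMinBiInvariant_isotypicSpan (hX : IsProjRep X) (hU : ∀ i, ∀ u ∈ U, X i u ∈ U)
    (hU0 : U ≠ ⊥) (hmin : ∀ U' ≤ U, (∀ i, ∀ u ∈ U', X i u ∈ U') → U' = ⊥ ∨ U' = U) :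
    IsMinBiInvariant X (isotypicSpan X U) := by
  refine ⟨fun h => hU0 (le_bot_iff.1 (h ▸ le_isotypicSpan)), isBiInvariant_isotypicSpan hU, ?_⟩
  intro W' hle hbi hne
  refine le_antisymm hle ?_
  obtain ⟨q, hq, hqW, hqid⟩ := hX.exists_projection hbi.1
  -- Some element of the commutant maps `U` injectively into `W'`.
  obtain ⟨b₁, hb₁, hb₁W, u₁, hu₁, hb₁u⟩ : ∃ b₁ : Module.End ℂ V, (∀ i, b₁ * X i = X i * b₁) ∧
      (∀ v, b₁ v ∈ W') ∧ ∃ u ∈ U, b₁ u ≠ 0 := by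
    by_contra! hcon
    have h0 : isotypicSpan X U ≤ LinearMap.ker q := by
      refine iSup_le ?_
      rintro b _ ⟨u, hu, rfl⟩
      exact hcon (q * b.1) (fun i => by rw [mul_assoc, b.2, ← mul_assoc, hq, mul_assoc])
        (fun v => hqW _) u hu
    apply hne
    rw [eq_bot_iff]
    intro w hw
    rw [Submodule.mem_bot, ← hqid w hw]
    exact LinearMap.mem_ker.1 (h0 (hle hw))
  have hinj : Function.Injective (b₁ ∘ₗ U.subtype) := by
    refine (injective_iff_map_eq_zero _).2 fun u hu => ?_
    have hk : U ⊓ LinearMap.ker b₁ = ⊥ := by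
      refine (hmin _ inf_le_left fun i v hv => ⟨hU i v hv.1, ?_⟩).resolve_right fun h => ?_
      · have := LinearMap.congr_fun (hb₁ i) v
        simp only [Module.End.mul_apply] at this
        exact LinearMap.mem_ker.2 (by rw [this, LinearMap.mem_ker.1 hv.2, map_zero])
      · exact hb₁u (LinearMap.mem_ker.1 (h.ge hu₁).2)
    have : (u : V) ∈ U ⊓ LinearMap.ker b₁ := ⟨u.2, hu⟩
    rw [hk, Submodule.mem_bot] at this
    exact Subtype.ext this
  let e := LinearEquiv.ofInjective (b₁ ∘ₗ U.subtype) hinj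
  have he : ∀ u, (e u : V) = b₁ u := fun u => rfl
  obtain ⟨p, hp, hpU, hpid⟩ := hX.exists_projection
    (W := LinearMap.range (b₁ ∘ₗ U.subtype)) (by
      rintro i _ ⟨u, rfl⟩
      exact ⟨⟨X i u, hU i u u.2⟩, LinearMap.congr_fun (hb₁ i) u⟩)
  let b₂ : Module.End ℂ V := U.subtype ∘ₗ e.symm.toLinearMap ∘ₗ p.codRestrict _ hpU
  have hb₂ : ∀ v, b₂ v = e.symm ⟨p v, hpU v⟩ := fun v => rfl
  have hb₂c : ∀ i, b₂ * X i = X i * b₂ := by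
    intro i
    ext v
    rw [Module.End.mul_apply, Module.End.mul_apply, hb₂, hb₂]
    set u := e.symm ⟨p v, hpU v⟩ with hu
    have h1 : e ⟨X i u, hU i u u.2⟩ = ⟨p (X i v), hpU _⟩ := by
      refine Subtype.ext ?_
      have h2 : b₁ u = p v := by rw [← he, hu, e.apply_symm_apply]
      have h3 := LinearMap.congr_fun (hb₁ i) (u : V)
      have h4 := LinearMap.congr_fun (hp i) v
      simp only [Module.End.mul_apply] at h3 h4
      rw [he, h3, h2]
      exact h4.symm
    rw [← h1, e.symm_apply_apply]
  have hb₂b₁ : ∀ u ∈ U, b₂ (b₁ u) = u := by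
    intro u hu
    have : e.symm ⟨p (b₁ u), hpU _⟩ = ⟨u, hu⟩ :=
      (LinearEquiv.symm_apply_eq e).2 (Subtype.ext (hpid _ ⟨⟨u, hu⟩, rfl⟩))
    rw [hb₂, this]
  refine iSup_le ?_
  rintro b _ ⟨u, hu, rfl⟩
  rw [← hb₂b₁ u hu]
  exact hbi.2 b.1 b.2 _ (hbi.2 b₂ hb₂c _ (hb₁W u))

/-- Distinct minimal bi-invariant subspaces are independent. -/
theorem sSupIndep_of_isMinBiInvariant (hX : IsProjRep X) {O : Set (Submodule ℂ V)}
    (hO : ∀ W ∈ O, IsMinBiInvariant X W) : sSupIndep O := by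
  intro W hW
  obtain ⟨p, hp, hpW, hpid⟩ := hX.exists_projection (hO W hW).bi.1
  have hker : sSup (O \ {W}) ≤ LinearMap.ker p := by
    refine sSup_le fun W' hW' w hw => ?_
    have hbi : IsBiInvariant X (W' ⊓ W) :=
      ⟨fun i v hv => ⟨(hO W' hW'.1).bi.1 i v hv.1, (hO W hW).bi.1 i v hv.2⟩,
        fun b hb v hv => ⟨(hO W' hW'.1).bi.2 b hb v hv.1, (hO W hW).bi.2 b hb v hv.2⟩⟩
    have h0 : W' ⊓ W = ⊥ := by
      by_contra hne
      exact hW'.2 (((hO W' hW'.1).min _ inf_le_left hbi hne).symm.trans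
        ((hO W hW).min _ inf_le_right hbi hne))
    have : p w ∈ W' ⊓ W := ⟨(hO W' hW'.1).bi.2 p hp w hw, hpW w⟩
    rwa [h0, Submodule.mem_bot] at this
  rw [Submodule.disjoint_def]
  intro w hw hw'
  rw [← hpid w hw]
  exact LinearMap.mem_ker.1 (hker hw')

end isotypic

namespace IsProjRep

variable {Q V : Type*} [Group Q] [AddCommGroup V] [Module ℂ V] {X : Q → Module.End ℂ V}

/-- The action of `Q` on the subspaces of a projective representation. -/
@[reducible] def mulAction (hX : IsProjRep X) : MulAction Q (Submodule ℂ V) where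
  smul g W := W.map (X g)
  one_smul W := by
    obtain ⟨c, hc, e⟩ := hX.one
    change W.map (X 1) = W
    rw [e, Submodule.map_smul _ _ _ hc]
    exact Submodule.map_id W
  mul_smul g h W := by
    obtain ⟨c, hc, e⟩ := hX.mul g h
    change W.map (X (g * h)) = (W.map (X h)).map (X g)
    rw [e, Submodule.map_smul _ _ _ hc]
    exact Submodule.map_comp (X h) (X g) W

theorem isBiInvariant_map (hX : IsProjRep X) (M : Subgroup Q) [M.Normal] (g : Q)
    {W : Submodule ℂ V} (hW : IsBiInvariant (fun m : M => X m) W) :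
    IsBiInvariant (fun m : M => X m) (W.map (X g)) := by
  refine ⟨?_, ?_⟩
  · rintro m _ ⟨w, hw, rfl⟩
    obtain ⟨c, hc, e⟩ := hX.mul m g
    obtain ⟨d, hd, e'⟩ := hX.mul g (g⁻¹ * m * g)
    have hm : g⁻¹ * m * g ∈ M := by simpa using Subgroup.Normal.conj_mem ‹_› m.1 m.2 g⁻¹
    rw [show g * (g⁻¹ * m * g) = m * g by group, e] at e'
    refine ⟨(c⁻¹ * d) • X (g⁻¹ * m * g) w, W.smul_mem _ (hW.1 ⟨_, hm⟩ w hw), ?_⟩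
    have := LinearMap.congr_fun e' w
    simp only [LinearMap.smul_apply, Module.End.mul_apply] at this
    rw [map_smul, mul_smul, ← this, inv_smul_smul₀ hc]
  · rintro b hb _ ⟨w, hw, rfl⟩
    refine ⟨hX.conj g⁻¹ b w, hW.2 _ (fun m => ?_) w hw, ?_⟩
    · have h1 : hX.conj m (hX.conj g⁻¹ b) = hX.conj g⁻¹ b := by
        have hm : g * m * g⁻¹ ∈ M := Subgroup.Normal.conj_mem ‹_› m.1 m.2 g
        rw [← hX.conj_mul, show m * g⁻¹ = g⁻¹ * (g * m * g⁻¹) by group, hX.conj_mul,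
          hX.conj_eq_self_iff.2 (hb ⟨_, hm⟩)]
      exact hX.conj_eq_self_iff.1 h1
    · have := hX.conj_mul_self g (hX.conj g⁻¹ b)
      rw [← hX.conj_mul, mul_inv_cancel, hX.conj_one] at this
      exact (LinearMap.congr_fun this w).symm

theorem isMinBiInvariant_map (hX : IsProjRep X) (M : Subgroup Q) [M.Normal] (g : Q)
    {W : Submodule ℂ V} (hW : IsMinBiInvariant (fun m : M => X m) W) :
    IsMinBiInvariant (fun m : M => X m) (W.map (X g)) := by
  let := hX.mulAction
  have hsmul : ∀ (h : Q) (W' : Submodule ℂ V), W'.map (X h) = h • W' := fun _ _ => rfl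
  refine ⟨fun h => hW.ne_bot ?_, hX.isBiInvariant_map M g hW.bi, fun W' hle hbi hne => ?_⟩
  · exact Submodule.map_injective_of_injective (hX.injective g) (h.trans (Submodule.map_bot _).symm)
  · have h1 := hW.min (W'.map (X g⁻¹)) ?_ (hX.isBiInvariant_map M _ hbi) fun h => hne ?_
    · rw [← h1, hsmul, hsmul, smul_inv_smul]
    · rw [← inv_smul_smul g W]
      exact Submodule.map_mono hle
    · exact Submodule.map_injective_of_injective (hX.injective g⁻¹)
        (h.trans (Submodule.map_bot _).symm)

/-- Clifford's theorem, geometric part: an irreducible projective representation of `Q` is induced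
from the stabilizer `T` of an isotypic component `W` with respect to the normal subgroup `M`. -/
theorem exists_stabilizer [Finite Q] [FiniteDimensional ℂ V] (hX : IsProjRep X)
    (hirr : ActsIrred X) (M : Subgroup Q) [M.Normal] {W : Submodule ℂ V}
    (hW : IsMinBiInvariant (fun m : M => X m) W) :
    ∃ (T : Subgroup Q) (_ : M ≤ T) (hT : ∀ t : T, ∀ w ∈ W, X t w ∈ W),
      ActsIrred (fun t : T => (X t).restrict (hT t)) ∧ finrank ℂ V = T.index * finrank ℂ W ∧
      ∀ g, LinearMap.trace ℂ V (X g) ≠ 0 → ∃ x, ∃ h : x⁻¹ * g * x ∈ T,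
        LinearMap.trace ℂ W ((X (x⁻¹ * g * x)).restrict (hT ⟨_, h⟩)) ≠ 0 := by
  classical
  let := hX.mulAction
  have hsmul : ∀ (h : Q) (W' : Submodule ℂ V), W'.map (X h) = h • W' := fun _ _ => rfl
  set T := MulAction.stabilizer Q W with hTdef
  have hTmem : ∀ t ∈ T, ∀ w ∈ W, X t w ∈ W := by
    intro t ht w hw
    rw [MulAction.mem_stabilizer_iff, ← hsmul] at ht
    rw [← ht]
    exact ⟨w, hw, rfl⟩
  have hinv : ∀ g (W' : Submodule ℂ V), (∀ w ∈ W', X g w ∈ W') → (∀ w ∈ W', X g⁻¹ w ∈ W') →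
      g • W' = W' := by
    intro g W' h h'
    refine le_antisymm ?_ fun w hw => ?_
    · rintro _ ⟨w, hw, rfl⟩
      exact h w hw
    · rw [← smul_inv_smul g W'] at hw
      obtain ⟨_, ⟨w', hw', rfl⟩, rfl⟩ := hw
      exact ⟨_, h' w' hw', rfl⟩
  have hMT : M ≤ T := fun m hm =>
    hinv m W (hW.bi.1 ⟨m, hm⟩) (hW.bi.1 ⟨m⁻¹, M.inv_mem hm⟩)
  let O := MulAction.orbit Q W
  have : Finite O := (Set.finite_range fun g : Q => g • W).to_subtype
  have := Fintype.ofFinite O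
  let N : O → Submodule ℂ V := fun i => i.1
  have hind : DirectSum.IsInternal N := by
    rw [DirectSum.isInternal_submodule_iff_iSupIndep_and_iSup_eq_top]
    refine ⟨(sSupIndep_iff _).1 (sSupIndep_of_isMinBiInvariant (hX.subgroup M) (O := O) ?_), ?_⟩
    · rintro _ ⟨g, rfl⟩
      exact hX.isMinBiInvariant_map M g hW
    · refine (hirr.eq_bot_or_eq_top _ fun g => ?_).resolve_left fun h => hW.ne_bot ?_
      · change iSup N ≤ (iSup N).comap (X g)
        refine iSup_le ?_
        rintro ⟨W', hW'⟩ w hw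
        exact (le_iSup N ⟨g • W', MulAction.mem_orbit_of_mem_orbit g hW'⟩) ⟨w, hw, rfl⟩
      · exact le_bot_iff.1 (h ▸ le_iSup N ⟨W, MulAction.mem_orbit_self W⟩)
  refine ⟨T, hMT, fun t => hTmem t t.2, ⟨?_, ?_⟩, ?_, ?_⟩
  · exact Submodule.nontrivial_iff_ne_bot.2 hW.ne_bot
  · intro W₀ hW₀
    -- The sum `L` of the translates of `W₀` is invariant, and `L ⊓ W = W₀` by independence.
    let W₁ : Submodule ℂ V := W₀.map W.subtype
    have hW₁W : W₁ ≤ W := Submodule.map_subtype_le W W₀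
    have hW₁ : ∀ t ∈ T, ∀ w ∈ W₁, X t w ∈ W₁ := by
      rintro t ht _ ⟨w, hw, rfl⟩
      exact ⟨_, hW₀ ⟨t, ht⟩ w hw, rfl⟩
    have hstab : ∀ t ∈ T, t • W₁ = W₁ := fun t ht =>
      hinv t W₁ (hW₁ t ht) (hW₁ _ (T.inv_mem ht))
    let L : Submodule ℂ V := ⨆ g : Q, g • W₁
    have hL : L = ⊥ ∨ L = ⊤ := by
      refine hirr.eq_bot_or_eq_top _ fun g => ?_
      change L ≤ L.comap (X g)
      refine iSup_le fun h => ?_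
      intro w hw
      refine (le_iSup (fun g : Q => g • W₁) (g * h)) ?_
      rw [mul_smul]
      exact ⟨w, hw, rfl⟩
    have hle : W₁ ≤ L := by
      have := le_iSup (fun g : Q => g • W₁) 1
      rwa [one_smul] at this
    have hinjW : Function.Injective (Submodule.map W.subtype) :=
      Submodule.map_injective_of_injective W.subtype_injective
    rcases hL with hL | hL
    · left
      apply hinjW
      rw [Submodule.map_bot]
      exact le_bot_iff.1 (hL ▸ hle)
    · right
      apply hinjW
      rw [Submodule.map_top, Submodule.range_subtype]
      refine le_antisymm hW₁W fun w hw => ?_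
      have hdisj : Disjoint W (sSup (O \ {W})) := by
        have := sSupIndep_of_isMinBiInvariant (hX.subgroup M) (O := O) (by
          rintro _ ⟨g, rfl⟩
          exact hX.isMinBiInvariant_map M g hW)
        exact this (MulAction.mem_orbit_self W)
      have hLle : L ≤ W₁ ⊔ sSup (O \ {W}) := by
        refine iSup_le fun g => ?_
        by_cases hg : g ∈ T
        · rw [hstab g hg]
          exact le_sup_left
        · refine le_trans (Submodule.map_mono hW₁W) (le_trans (le_sSup ?_) le_sup_right)
          exact ⟨⟨g, rfl⟩, fun h => hg h⟩
      obtain ⟨w₁, hw₁, w₂, hw₂, e⟩ := Submodule.mem_sup.1 (hLle (hL ▸ Submodule.mem_top : w ∈ L))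
      have h2 : w₂ ∈ W := by
        rw [show w₂ = w - w₁ by rw [← e]; abel]
        exact W.sub_mem hw (hW₁W hw₁)
      rw [Submodule.disjoint_def.1 hdisj w₂ h2 hw₂, add_zero] at e
      rwa [← e]
  · rw [finrank_eq_sum_of_isInternal hind, MulAction.index_stabilizer, ← Nat.card_coe_set_eq,
      Nat.card_eq_fintype_card]
    rw [Finset.sum_congr rfl (g := fun _ => finrank ℂ W), Finset.sum_const, Finset.card_univ,
      smul_eq_mul]
    rintro ⟨_, g, rfl⟩ -
    exact (LinearEquiv.finrank_eq (Submodule.equivMapOfInjective _ (hX.injective g) W)).symm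
  · intro g hg
    obtain ⟨⟨_, x, rfl⟩, hi, htr⟩ := exists_trace_restrict_ne_zero hind (f := X g) (by
      rintro ⟨W', hW'⟩
      exact ⟨⟨g • W', MulAction.mem_orbit_of_mem_orbit g hW'⟩, fun v hv => ⟨v, hv, rfl⟩⟩) hg
    have hx : x⁻¹ * g * x ∈ T := by
      rw [MulAction.mem_stabilizer_iff, mul_smul, mul_smul, inv_smul_eq_iff]
      change (x • W).map (X g) = x • W
      refine Submodule.eq_of_le_of_finrank_eq ?_ ?_
      · rintro _ ⟨w, hw, rfl⟩
        exact hi w hw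
      · exact (LinearEquiv.finrank_eq
          (Submodule.equivMapOfInjective _ (hX.injective g) _)).symm
    refine ⟨x, hx, fun h0 => htr ?_⟩
    let e := Submodule.equivMapOfInjective _ (hX.injective x) W
    obtain ⟨c, hc, ec⟩ := hX.mul x (x⁻¹ * g * x)
    obtain ⟨d, hd, ed⟩ := hX.mul g x
    rw [show x * (x⁻¹ * g * x) = g * x by group, ed] at ec
    have key : (X g).restrict hi =
        (d⁻¹ * c) • e.conj ((X (x⁻¹ * g * x)).restrict (hTmem _ hx)) := by
      ext w
      obtain ⟨w, rfl⟩ := e.surjective w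
      rw [LinearMap.smul_apply, LinearEquiv.conj_apply_apply, e.symm_apply_apply]
      have h1 := LinearMap.congr_fun ec w
      simp only [LinearMap.smul_apply, Module.End.mul_apply] at h1
      change X g (X x w) = (d⁻¹ * c) • X x (X (x⁻¹ * g * x) w)
      rw [mul_smul, ← h1, inv_smul_smul₀ hd]
    exact (congrArg _ key).trans (by rw [map_smul, LinearMap.trace_conj', h0, smul_zero])

/-- Clifford theory for an irreducible projective representation `X` of `Q`, a normal subgroup `M`
and a simple `M`-subspace `U`: there are a subgroup `T` containing `M` and projective
representations `b`, `a` of `T`, where `a` extends the action of `M` on `U` and `b` is scalar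
on `M`, such that `X` is induced from `b ⊗ a`. -/
theorem clifford {Q : Type*} [Group Q] [Finite Q] {V : Type} [AddCommGroup V] [Module ℂ V]
    [FiniteDimensional ℂ V] {X : Q → Module.End ℂ V} (hX : IsProjRep X) (hirr : ActsIrred X)
    (M : Subgroup Q) [M.Normal] {U : Submodule ℂ V} (hU : ∀ m : M, ∀ u ∈ U, X m u ∈ U)
    (hUirr : ActsIrred fun m : M => (X m).restrict (hU m)) :
    ∃ (T : Subgroup Q) (hMT : M ≤ T) (Y : Type) (_ : AddCommGroup Y) (_ : Module ℂ Y)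
      (_ : FiniteDimensional ℂ Y) (b : T → Module.End ℂ Y) (a : T → Module.End ℂ U),
      IsProjRep b ∧ IsProjRep a ∧ ActsIrred b ∧
      (∀ m : M, ∃ c : ℂ, c ≠ 0 ∧ b ⟨m, hMT m.2⟩ = c • 1) ∧
      (∀ m : M, ∃ c : ℂ, c ≠ 0 ∧ a ⟨m, hMT m.2⟩ = c • (X m).restrict (hU m)) ∧
      finrank ℂ V = T.index * (finrank ℂ Y * finrank ℂ U) ∧
      ∀ g, LinearMap.trace ℂ V (X g) ≠ 0 → ∃ x, ∃ h : x⁻¹ * g * x ∈ T,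
        LinearMap.trace ℂ Y (b ⟨_, h⟩) ≠ 0 ∧ LinearMap.trace ℂ U (a ⟨_, h⟩) ≠ 0 := by
  have hU0 : U ≠ ⊥ := Submodule.nontrivial_iff_ne_bot.1 hUirr.nontrivial
  have hmin : ∀ U' ≤ U, (∀ m : M, ∀ u ∈ U', X m u ∈ U') → U' = ⊥ ∨ U' = U := by
    intro U' hle hinv
    rcases hUirr.eq_bot_or_eq_top (U'.comap U.subtype) fun m u hu => hinv m u hu with h | h
    · left
      rw [← inf_eq_right.2 hle, ← Submodule.map_comap_subtype, h, Submodule.map_bot]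
    · right
      exact le_antisymm hle (Submodule.comap_subtype_eq_top.1 h)
  have hW := isMinBiInvariant_isotypicSpan (hX.subgroup M) hU hU0 hmin
  set W := isotypicSpan (fun m : M => X m) U with hWdef
  obtain ⟨T, hMT, hT, hTirr, hdim, htr⟩ := hX.exists_stabilizer hirr M hW
  have hXT : IsProjRep (fun t : T => (X t).restrict (hT t)) := (hX.subgroup T).restrict hT
  have hWn := hTirr.nontrivial
  have := (inferInstance : (M.subgroupOf T).Normal)
  have hMfin : Finite (M.subgroupOf T) := inferInstance
  let i : M.subgroupOf T → M := fun m => ⟨m.1.1, m.2⟩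
  have hσ : IsProjRep (fun m : M.subgroupOf T => (X (i m)).restrict (hU (i m))) :=
    ((hX.subgroup M).restrict hU).comp
      { toFun := i, map_one' := rfl, map_mul' := fun _ _ => rfl }
  have hσirr : ActsIrred (fun m : M.subgroupOf T => (X (i m)).restrict (hU (i m))) :=
    hUirr.of_forall_invariant fun W' h m => h ⟨⟨m, hMT m.2⟩, m.2⟩
  obtain ⟨Y, i1, i2, i3, E, b, a, hdec, hb, ha⟩ :=
    exists_isTensorDecomp hXT (M.subgroupOf T) hσ hσirr (by
      rw [eq_top_iff]
      have hle : W ≤ (⨆ f ∈ homSpace (fun m : M.subgroupOf T => (X (i m)).restrict (hU (i m)))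
          (fun m : M.subgroupOf T => (X m).restrict (hT m)),
          LinearMap.range f).map W.subtype := by
        refine iSup_le ?_
        rintro ⟨c, hc⟩ _ ⟨u, hu, rfl⟩
        have hcW : ∀ u : U, c u ∈ W := fun u => hW.bi.2 c hc _ (le_isotypicSpan u.2)
        refine ⟨⟨c u, hcW ⟨u, hu⟩⟩, ?_, rfl⟩
        refine (le_iSup₂ (f := fun (f : U →ₗ[ℂ] W) (_ : f ∈ homSpace
          (fun m : M.subgroupOf T => (X (i m)).restrict (hU (i m)))
          (fun m : M.subgroupOf T => (X m).restrict (hT m))) => LinearMap.range f)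
          ((c ∘ₗ U.subtype).codRestrict W hcW) ?_) ⟨⟨u, hu⟩, rfl⟩
        refine mem_homSpace.2 fun m u => Subtype.ext ?_
        exact LinearMap.congr_fun (hc (i m)) u
      intro w _
      obtain ⟨w', hw', e⟩ := hle w.2
      rwa [← Subtype.ext e])
  refine ⟨T, hMT, Y, i1, i2, i3, b, a, hdec.isProjRep_left hXT, hdec.isProjRep_right hXT,
    hdec.actsIrred_left (s := id) hTirr, fun m => hb ⟨⟨m, hMT m.2⟩, m.2⟩,
    fun m => ha ⟨⟨m, hMT m.2⟩, m.2⟩, ?_, fun g hg => ?_⟩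
  · rw [hdim, ← LinearEquiv.finrank_eq E, finrank_tensorProduct]
  · obtain ⟨x, hx, h⟩ := htr g hg
    refine ⟨x, hx, ?_⟩
    have := hdec.trace_eq ⟨_, hx⟩
    rw [← mul_ne_zero_iff, ← this]
    exact h

end IsProjRep

/-! ### Traces of operators of finite order -/

section finiteOrder

variable {V : Type*} [AddCommGroup V] [Module ℂ V]

/-- An operator of finite order is diagonalizable, with roots of unity as eigenvalues. -/
theorem exists_eigenbasis_of_pow_eq_one [FiniteDimensional ℂ V] {f : Module.End ℂ V} {n : ℕ}
    (hn : n ≠ 0) (hf : f ^ n = 1) : ∃ (ι : Type) (_ : Fintype ι) (b : Basis ι ℂ V) (μ : ι → ℂ),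
      (∀ i, f (b i) = μ i • b i) ∧ ∀ i, ‖μ i‖ = 1 := by
  classical
  have hss : f.IsSemisimple := by
    refine Module.End.isSemisimple_of_squarefree_aeval_eq_zero (p := Polynomial.X ^ n - 1) ?_ ?_
    · refine (Polynomial.separable_X_pow_sub_C (1 : ℂ) ?_ one_ne_zero).squarefree
      exact_mod_cast hn
    · simp [hf]
  have hint : DirectSum.IsInternal fun μ : ℂ => f.eigenspace μ := by
    rw [DirectSum.isInternal_submodule_iff_iSupIndep_and_iSup_eq_top]
    refine ⟨f.eigenspaces_iSupIndep, ?_⟩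
    rw [← f.iSup_maxGenEigenspace_eq_top]
    exact iSup_congr fun μ =>
      (hss.isFinitelySemisimple.maxGenEigenspace_eq_eigenspace μ).symm
  let b := hint.collectedBasis fun μ => finBasis ℂ (f.eigenspace μ)
  have hb : ∀ i, f (b i) = i.1 • b i := by
    intro i
    have : b i ∈ f.eigenspace i.1 := by
      rw [hint.collectedBasis_coe]
      exact Submodule.coe_mem _
    exact End.mem_eigenspace_iff.1 this
  refine ⟨_, FiniteDimensional.fintypeBasisIndex b, b, fun i => i.1, hb, fun i => ?_⟩
  have h1 : ∀ k : ℕ, (f ^ k) (b i) = i.1 ^ k • b i := by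
    intro k
    induction k with
    | zero => simp
    | succ k ih => rw [pow_succ', Module.End.mul_apply, ih, map_smul, hb, smul_smul, pow_succ]
  have h2 := h1 n
  rw [hf, Module.End.one_apply] at h2
  have h3 : i.1 ^ n = 1 := by
    have := smul_left_injective ℂ (b.ne_zero i) (a₁ := i.1 ^ n) (a₂ := 1)
    exact this (by simpa using h2.symm)
  exact Complex.norm_eq_one_of_pow_eq_one h3 hn

theorem trace_eq_sum_of_eigenbasis {ι : Type*} [Fintype ι] (b : Basis ι ℂ V) {μ : ι → ℂ}
    {f : Module.End ℂ V} (hf : ∀ i, f (b i) = μ i • b i) :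
    LinearMap.trace ℂ V f = ∑ i, μ i := by
  classical
  rw [LinearMap.trace_eq_matrix_trace ℂ b, Matrix.trace]
  refine Finset.sum_congr rfl fun i _ => ?_
  rw [Matrix.diag_apply, LinearMap.toMatrix_apply, hf]
  simp

theorem eq_one_of_trace_eq_finrank [FiniteDimensional ℂ V] {f : Module.End ℂ V} {n : ℕ}
    (hn : n ≠ 0) (hf : f ^ n = 1) (htr : LinearMap.trace ℂ V f = finrank ℂ V) : f = 1 := by
  obtain ⟨ι, hι, b, μ, hb, hμ⟩ := exists_eigenbasis_of_pow_eq_one hn hf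
  rw [trace_eq_sum_of_eigenbasis b hb, finrank_eq_card_basis b] at htr
  have hre : ∀ i, (μ i).re ≤ 1 := fun i => (Complex.re_le_norm _).trans (hμ i).le
  have hsum : ∑ i, (1 - (μ i).re) = 0 := by
    have := congrArg Complex.re htr
    rw [Complex.re_sum, Complex.natCast_re] at this
    rw [Finset.sum_sub_distrib, this]
    simp
  have h1 := (Finset.sum_eq_zero_iff_of_nonneg fun i _ => sub_nonneg.2 (hre i)).1 hsum
  refine b.ext fun i => ?_
  have h2 : (μ i).re = 1 := by linarith [h1 i (Finset.mem_univ i)]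
  have h3 : μ i = 1 := by
    have h4 := Complex.sq_norm (μ i)
    rw [hμ, Complex.normSq_apply, h2] at h4
    refine Complex.ext h2 ?_
    have : (μ i).im * (μ i).im = 0 := by linarith
    simpa using this
  rw [hb, h3, one_smul, Module.End.one_apply]

theorem conj_trace_of_pow_eq_one [FiniteDimensional ℂ V] {f f' : Module.End ℂ V} {n : ℕ}
    (hn : n ≠ 0) (hf : f ^ n = 1) (hff' : f' * f = 1) :
    (starRingEnd ℂ) (LinearMap.trace ℂ V f) = LinearMap.trace ℂ V f' := by
  obtain ⟨ι, hι, b, μ, hb, hμ⟩ := exists_eigenbasis_of_pow_eq_one hn hf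
  have hb' : ∀ i, f' (b i) = (starRingEnd ℂ) (μ i) • b i := by
    intro i
    have h0 : μ i ≠ 0 := norm_ne_zero_iff.1 (by rw [hμ]; exact one_ne_zero)
    have h1 := LinearMap.congr_fun hff' (b i)
    rw [Module.End.mul_apply, hb, map_smul, Module.End.one_apply] at h1
    rw [← Complex.inv_eq_conj (hμ i), ← h1, smul_smul, inv_mul_cancel₀ h0, one_smul, h1]
  rw [trace_eq_sum_of_eigenbasis b hb, trace_eq_sum_of_eigenbasis b hb', map_sum]

end finiteOrder

/-! ### Irreducible characters and irreducible families -/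

section irreducible

variable {G V : Type*} [Group G] [AddCommGroup V] [Module ℂ V]

theorem Representation.IsIrreducible.actsIrred {ρ : Representation ℂ G V} (h : ρ.IsIrreducible) :
    ActsIrred ρ := by
  refine ⟨?_, fun W hW => ?_⟩
  · obtain ⟨A, B, hAB⟩ := h.toNontrivial
    by_contra hV
    rw [not_nontrivial_iff_subsingleton] at hV
    exact hAB (Subrepresentation.toSubmodule_injective (Subsingleton.elim _ _))
  · rcases h.eq_bot_or_eq_top ⟨W, fun g v hv => hW g v hv⟩ with h | h
    · exact Or.inl (congrArg Subrepresentation.toSubmodule h)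
    · exact Or.inr (congrArg Subrepresentation.toSubmodule h)

theorem ActsIrred.isIrreducible {ρ : Representation ℂ G V} (h : ActsIrred ρ) :
    ρ.IsIrreducible := by
  have := h.nontrivial
  have : Nontrivial (Subrepresentation ρ) :=
    ⟨⊥, ⊤, fun h => bot_ne_top (α := Submodule ℂ V) (congrArg Subrepresentation.toSubmodule h)⟩
  refine { eq_bot_or_eq_top := fun W => ?_ }
  rcases h.eq_bot_or_eq_top W.toSubmodule fun g w hw => W.apply_mem_toSubmodule g hw with h | h
  · exact Or.inl (Subrepresentation.toSubmodule_injective h)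
  · exact Or.inr (Subrepresentation.toSubmodule_injective h)

theorem Representation.isProjRep (ρ : Representation ℂ G V) : IsProjRep ρ :=
  ⟨⟨1, one_ne_zero, by rw [map_one, one_smul]⟩,
    fun g h => ⟨1, one_ne_zero, by rw [map_mul, one_smul]⟩⟩

theorem isIrrChar_of_actsIrred [FiniteDimensional ℂ V] (ρ : Representation ℂ G V)
    (h : ActsIrred ρ) : IsIrrChar ρ.character := by
  let e := (finBasis ℂ V).equivFun
  let ρ' : Representation ℂ G (Fin (finrank ℂ V) → ℂ) :=
    { toFun := fun g => e.conj (ρ g)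
      map_one' := by rw [map_one]; exact LinearEquiv.conj_id e
      map_mul' := fun g h => by rw [map_mul]; exact LinearEquiv.conj_comp e (ρ h) (ρ g) }
  refine ⟨_, ρ', ?_, ?_⟩
  · apply ActsIrred.isIrreducible
    have := h.nontrivial
    refine ⟨e.symm.toEquiv.nontrivial, fun W hW => ?_⟩
    have key : (W.comap e.toLinearMap).map e.toLinearMap = W :=
      Submodule.map_comap_eq_of_surjective e.surjective W
    rcases h.eq_bot_or_eq_top (W.comap e.toLinearMap) fun g w hw => by
        have h1 := hW g _ hw
        change e (ρ g (e.symm (e w))) ∈ W at h1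
        rwa [e.symm_apply_apply] at h1 with h0 | h0
    · left
      rw [← key, h0, Submodule.map_bot]
    · right
      rw [← key, h0, Submodule.map_top, LinearMap.range_eq_top]
      exact e.surjective
  · ext g
    exact (LinearMap.trace_conj' (ρ g) e).symm

end irreducible

/-! ### Commuting operators and perfect subgroups -/

theorem commutator_eq_self_of_isSimpleGroup {Q : Type*} [Group Q] (K : Subgroup Q)
    [IsSimpleGroup K] (hK : ∃ a ∈ K, ∃ b ∈ K, a * b ≠ b * a) : ⁅K, K⁆ = K := by
  have h1 : commutator K = ⊤ := by
    refine ((inferInstance : (commutator K).Normal).eq_bot_or_eq_top).resolve_left fun h => ?_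
    obtain ⟨a, ha, b, hb, hab⟩ := hK
    have h2 : ⁅(⟨a, ha⟩ : K), (⟨b, hb⟩ : K)⁆ ∈ commutator K :=
      Subgroup.commutator_mem_commutator (Subgroup.mem_top _) (Subgroup.mem_top _)
    rw [h, Subgroup.mem_bot, commutatorElement_eq_one_iff_mul_comm] at h2
    exact hab (congrArg Subtype.val h2)
  have h2 := congrArg (Subgroup.map K.subtype) h1
  rwa [commutator_def, Subgroup.map_commutator, ← MonoidHom.range_eq_map,
    Subgroup.range_subtype] at h2

namespace IsProjRep

variable {Q V : Type*} [Group Q] [AddCommGroup V] [Module ℂ V] {X : Q → Module.End ℂ V}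

/-- The subgroup of the elements `g` for which `X g` commutes with a given operator. -/
def centralizing (hX : IsProjRep X) (T : Module.End ℂ V) : Subgroup Q where
  carrier := {g | hX.conj g T = T}
  one_mem' := hX.conj_one T
  mul_mem' {g h} hg hh := by
    change hX.conj (g * h) T = T
    rw [hX.conj_mul, hh, hg]
  inv_mem' {g} hg := by
    change hX.conj g⁻¹ T = T
    nth_rewrite 1 [← (hg : hX.conj g T = T)]
    rw [← hX.conj_mul, inv_mul_cancel, hX.conj_one]

theorem mem_centralizing (hX : IsProjRep X) {T : Module.End ℂ V} {g : Q} :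
    g ∈ hX.centralizing T ↔ T * X g = X g * T := hX.conj_eq_self_iff

/-- If `q` commutes with a perfect subgroup `K`, then `X q` commutes with `X k` for all `k` in `K`:
the two operators commute up to a scalar that is a linear character of `K`. -/
theorem commute_of_perfect (hX : IsProjRep X) {K : Subgroup Q} (hK : ⁅K, K⁆ = K) {q : Q}
    (hq : ∀ k ∈ K, k * q = q * k) : ∀ k ∈ K, X q * X k = X k * X q := by
  have key : ⁅K, K⁆ ≤ hX.centralizing (X q) := by
    rw [Subgroup.commutator_le]
    intro k hk l hl
    have hc : ∀ k ∈ K, ∃ c : ℂ, hX.conj k (X q) = c • X q := by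
      intro k hk
      obtain ⟨c, -, e⟩ := hX.conj_apply_self k q
      rw [hq k hk, mul_inv_cancel_right] at e
      exact ⟨c, e⟩
    obtain ⟨c, ec⟩ := hc k hk
    obtain ⟨c', ec'⟩ := hc _ (K.inv_mem hk)
    obtain ⟨d, ed⟩ := hc l hl
    obtain ⟨d', ed'⟩ := hc _ (K.inv_mem hl)
    have h1 : (c' * c) • X q = X q := by
      have h := hX.conj_one (X q)
      rw [← mul_inv_cancel k, hX.conj_mul, ec', map_smul, ec, smul_smul] at h
      exact h
    have h2 : (d' * d) • X q = X q := by
      have h := hX.conj_one (X q)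
      rw [← mul_inv_cancel l, hX.conj_mul, ed', map_smul, ed, smul_smul] at h
      exact h
    change hX.conj (k * l * k⁻¹ * l⁻¹) (X q) = X q
    rw [hX.conj_mul, hX.conj_mul, hX.conj_mul, ed', map_smul, ec', map_smul, map_smul,
      map_smul, ed, map_smul, map_smul, ec]
    calc d' • c' • d • c • X q = (d' * d) • (c' * c) • X q := by simp only [smul_smul]; ring_nf
      _ = X q := by rw [h1, h2]
  intro k hk
  exact hX.mem_centralizing.1 (key (hK.ge hk))

/-- A projective representation is faithful if only the identity acts by a scalar. -/
def Faithful (X : Q → Module.End ℂ V) : Prop := ∀ q, (∃ c : ℂ, X q = c • 1) → q = 1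

theorem eq_of_eq_smul (hX : IsProjRep X) (hf : Faithful X) {q q' : Q} {c : ℂ}
    (h : X q = c • X q') : q = q' := by
  obtain ⟨d, hd, e⟩ := hX.mul q'⁻¹ q
  obtain ⟨d', hd', e'⟩ := hX.mul q'⁻¹ q'
  obtain ⟨z, hz, e1⟩ := hX.one
  rw [inv_mul_cancel, e1] at e'
  have : q'⁻¹ * q = 1 := by
    refine hf _ ⟨d * c * d'⁻¹ * z, ?_⟩
    rw [e, h, mul_smul_comm, mul_smul _ z, e', smul_smul, smul_smul,
      inv_mul_cancel_right₀ hd']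
  exact (inv_mul_eq_one.1 this).symm

end IsProjRep

/-! ### The finite central cover of determinant one -/

namespace IsProjRep

variable {Q V : Type*} [Group Q] [AddCommGroup V] [Module ℂ V] {X : Q → Module.End ℂ V}

/-- The group of operators of determinant one that are scalar multiples of some `X q`. For finite
`Q` and a faithful `X` it is a finite central extension of `Q`. -/
def specialCover (hX : IsProjRep X) : Subgroup (Module.End ℂ V)ˣ where
  carrier := {u | LinearMap.det (u : Module.End ℂ V) = 1 ∧
    ∃ q, ∃ c : ℂ, c ≠ 0 ∧ (u : Module.End ℂ V) = c • X q}
  one_mem' := by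
    obtain ⟨c, hc, e⟩ := hX.one
    exact ⟨by simp, 1, c⁻¹, inv_ne_zero hc, by rw [e, inv_smul_smul₀ hc, Units.val_one]⟩
  mul_mem' := by
    rintro u v ⟨hu, q, c, hc, e⟩ ⟨hv, q', c', hc', e'⟩
    obtain ⟨d, hd, ed⟩ := hX.mul q q'
    refine ⟨by rw [Units.val_mul, map_mul, hu, hv, one_mul], q * q', c * c' * d⁻¹,
      mul_ne_zero (mul_ne_zero hc hc') (inv_ne_zero hd), ?_⟩
    rw [Units.val_mul, e, e', ed, mul_smul, inv_smul_smul₀ hd, smul_mul_smul_comm]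
  inv_mem' := by
    rintro u ⟨hu, q, c, hc, e⟩
    have hdet : LinearMap.det ((u⁻¹ : (Module.End ℂ V)ˣ) : Module.End ℂ V) = 1 := by
      have := congrArg LinearMap.det u.inv_mul
      rwa [map_mul, hu, mul_one, map_one] at this
    refine ⟨hdet, q⁻¹, ?_⟩
    obtain ⟨a, ha, h1⟩ := hX.one
    obtain ⟨d, hd, ed⟩ := hX.mul q q⁻¹
    rw [mul_inv_cancel, h1] at ed
    refine ⟨c⁻¹ * a⁻¹ * d, mul_ne_zero (mul_ne_zero (inv_ne_zero hc) (inv_ne_zero ha)) hd, ?_⟩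
    refine Units.inv_eq_of_mul_eq_one_right ?_
    rw [e, smul_mul_smul_comm]
    rw [show c * (c⁻¹ * a⁻¹ * d) = a⁻¹ * d by field_simp, mul_smul, ← ed, inv_smul_smul₀ ha]

/-- The projection of the special cover onto `Q`. -/
theorem exists_specialCover_hom [Nontrivial V] (hX : IsProjRep X) (hf : Faithful X) :
    ∃ π : hX.specialCover →* Q, ∀ u : hX.specialCover, ∃ c : ℂ, c ≠ 0 ∧
      ((u : (Module.End ℂ V)ˣ) : Module.End ℂ V) = c • X (π u) := by
  choose p hp using fun u : hX.specialCover => u.2.2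
  have huniq : ∀ (u : hX.specialCover) (q : Q) (c : ℂ), c ≠ 0 →
      ((u : (Module.End ℂ V)ˣ) : Module.End ℂ V) = c • X q → p u = q := by
    intro u q c hc h
    obtain ⟨d, hd, e⟩ := hp u
    refine hX.eq_of_eq_smul hf (c := d⁻¹ * c) ?_
    rw [mul_smul, ← h, e, inv_smul_smul₀ hd]
  refine ⟨MonoidHom.mk' p fun u v => ?_, hp⟩
  obtain ⟨c, hc, e⟩ := hp u
  obtain ⟨c', hc', e'⟩ := hp v
  obtain ⟨d, hd, ed⟩ := hX.mul (p u) (p v)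
  refine huniq _ _ (c * c' * d⁻¹) (mul_ne_zero (mul_ne_zero hc hc') (inv_ne_zero hd)) ?_
  rw [Subgroup.coe_mul, Units.val_mul, e, e', ed, mul_smul, inv_smul_smul₀ hd,
    smul_mul_smul_comm]

theorem exists_mem_specialCover [FiniteDimensional ℂ V] [Nontrivial V] (hX : IsProjRep X) (q : Q) :
    ∃ u ∈ hX.specialCover, ∃ c : ℂ, c ≠ 0 ∧ (u : Module.End ℂ V) = c • X q := by
  have hdet : LinearMap.det (X q) ≠ 0 := by
    have := (hX.unit q).isUnit.map (LinearMap.det (A := ℂ) (M := V))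
    rw [hX.unit_val] at this
    exact this.ne_zero
  obtain ⟨c, hc⟩ := IsAlgClosed.exists_pow_nat_eq (LinearMap.det (X q))⁻¹
    (finrank_pos (R := ℂ) (M := V))
  have hc0 : c ≠ 0 := by
    rintro rfl
    rw [zero_pow (finrank_pos (R := ℂ) (M := V)).ne'] at hc
    exact inv_ne_zero hdet hc.symm
  have hval : ((Units.mk0 c hc0 • hX.unit q : (Module.End ℂ V)ˣ) : Module.End ℂ V) = c • X q := by
    rw [Units.val_smul, hX.unit_val]
    rfl
  refine ⟨Units.mk0 c hc0 • hX.unit q, ⟨?_, q, c, hc0, hval⟩, c, hc0, hval⟩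
  rw [hval, LinearMap.det_smul, hc, inv_mul_cancel₀ hdet]

theorem finite_specialCover [Finite Q] [FiniteDimensional ℂ V] [Nontrivial V] (hX : IsProjRep X) :
    Finite hX.specialCover := by
  choose s hs c hc hsc using hX.exists_mem_specialCover
  have hd : 0 < finrank ℂ V := finrank_pos
  let Z := {z : ℂ // z ∈ Polynomial.nthRootsFinset (finrank ℂ V) (1 : ℂ)}
  let F : Q × Z → Module.End ℂ V := fun p => p.2.1 • (s p.1 : Module.End ℂ V)
  have : (Set.range F).Finite := Set.finite_range F
  refine Set.Finite.to_subtype (Set.Finite.of_finite_image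
    (f := fun u : (Module.End ℂ V)ˣ => (u : Module.End ℂ V)) (this.subset ?_)
    (fun u _ v _ h => Units.ext h))
  rintro _ ⟨u, ⟨hu, q, k, hk, e⟩, rfl⟩
  have e' : (u : Module.End ℂ V) = (k * (c q)⁻¹) • (s q : Module.End ℂ V) := by
    rw [hsc, mul_smul, inv_smul_smul₀ (hc q), e]
  refine ⟨(q, ⟨k * (c q)⁻¹, ?_⟩), e'.symm⟩
  rw [Polynomial.mem_nthRootsFinset hd]
  have h1 := hu
  rwa [e', LinearMap.det_smul, (hs q).1, mul_one] at h1

end IsProjRep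

/-! ### Almost simple groups and the conjecture -/

theorem isAlmostSimple_of_subgroup {X : Type} [Group X] (K : Subgroup X) [K.Normal]
    [IsSimpleGroup K] (hK : ∃ a ∈ K, ∃ b ∈ K, a * b ≠ b * a)
    (hcent : ∀ x : X, (∀ k ∈ K, k * x = x * k) → x = 1) : IsAlmostSimple X := by
  refine ⟨K, inferInstance, inferInstance, ?_, MulAut.conjNormal, ?_, ?_⟩
  · obtain ⟨a, ha, b, hb, hab⟩ := hK
    exact ⟨⟨a, ha⟩, ⟨b, hb⟩, fun h => hab (congrArg Subtype.val h)⟩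
  · refine (injective_iff_map_eq_one _).2 fun x hx => hcent x fun k hk => ?_
    have := congrArg Subtype.val (DFunLike.congr_fun hx ⟨k, hk⟩)
    rw [MulAut.conjNormal_apply] at this
    exact (mul_inv_eq_iff_eq_mul.1 this).symm
  · rintro _ ⟨k, rfl⟩
    exact ⟨k, by ext l; simp [MulAut.conjNormal_apply]⟩

theorem isAlmostSimple_of_mulEquiv {X : Type} [Group X] {Q : Type*} [Group Q] (e : X ≃* Q)
    (K : Subgroup Q) [K.Normal] [IsSimpleGroup K] (hK : ∃ a ∈ K, ∃ b ∈ K, a * b ≠ b * a)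
    (hcent : ∀ x : Q, (∀ k ∈ K, k * x = x * k) → x = 1) : IsAlmostSimple X := by
  have : (K.map e.symm.toMonoidHom).Normal :=
    Subgroup.Normal.map inferInstance _ e.symm.surjective
  have : IsSimpleGroup (K.map e.symm.toMonoidHom) := (e.symm.subgroupMap K).symm.isSimpleGroup
  refine isAlmostSimple_of_subgroup (K.map e.symm.toMonoidHom) ?_ fun x hx => ?_
  · obtain ⟨a, ha, b, hb, hab⟩ := hK
    refine ⟨e.symm a, ⟨a, ha, rfl⟩, e.symm b, ⟨b, hb, rfl⟩, fun h => hab ?_⟩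
    rw [← map_mul, ← map_mul] at h
    exact e.symm.injective h
  · have h1 := hcent (e x) fun k hk => by
      have := congrArg e (hx _ ⟨k, hk, rfl⟩)
      rw [map_mul, map_mul] at this
      simpa using this
    simpa using h1

theorem exists_solvableResidual_eq (G : Type*) [Group G] [Finite G] :
    ∃ n, solvableResidual G = derivedSeries G n := by
  obtain ⟨n, hn⟩ := WellFoundedGT.monotone_chain_condition
    (⟨fun n => OrderDual.toDual (derivedSeries G n), fun _ _ h => derivedSeries_antitone G h⟩ :
      ℕ →o (Subgroup G)ᵒᵈ)
  refine ⟨n, le_antisymm (iInf_le _ n) (le_iInf fun m => ?_)⟩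
  rcases le_total n m with h | h
  · exact (OrderDual.toDual.injective (hn m h)).le
  · exact derivedSeries_antitone G h

theorem le_derivedSeries_of_perfect {Q : Type*} [Group Q] {K : Subgroup Q} (hK : ⁅K, K⁆ = K)
    (n : ℕ) : K ≤ derivedSeries Q n := by
  induction n with
  | zero => exact le_top
  | succ n ih =>
    rw [derivedSeries_succ, ← hK]
    exact Subgroup.commutator_mono ih ih

/-- The conjecture on nearly simple groups, for faithful projective representations of almost simple
groups: it applies to the special cover, which is a central extension with quotient `Q`. -/
theorem NearlySimpleConjecture.orderOf_mul_finrank_dvd (hconj : NearlySimpleConjecture)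
    {Q : Type*} [Group Q] [Finite Q] {V : Type} [AddCommGroup V] [Module ℂ V]
    [FiniteDimensional ℂ V] {X : Q → Module.End ℂ V} (hX : IsProjRep X)
    (hf : IsProjRep.Faithful X) (K : Subgroup Q) [K.Normal] [IsSimpleGroup K]
    (hK : ∃ a ∈ K, ∃ b ∈ K, a * b ≠ b * a) (hirr : ActsIrred fun k : K => X k) {h : Q}
    (hgen : K ⊔ Subgroup.zpowers h = ⊤) (htr : LinearMap.trace ℂ V (X h) ≠ 0) :
    orderOf h * finrank ℂ V ∣ Nat.card Q := by
  have := hirr.nontrivial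
  have hperf := commutator_eq_self_of_isSimpleGroup K hK
  let Γ := hX.specialCover
  obtain ⟨π, hπ⟩ : ∃ π : Γ →* Q, ∀ u : Γ, ∃ c : ℂ, c ≠ 0 ∧
      ((u : (Module.End ℂ V)ˣ) : Module.End ℂ V) = c • X (π u) := hX.exists_specialCover_hom hf
  have hfin : Finite Γ := hX.finite_specialCover
  have hπeq : ∀ (u : Γ) (q : Q) (c : ℂ), ((u : (Module.End ℂ V)ˣ) : Module.End ℂ V) = c • X q →
      π u = q := by
    intro u q c hc
    obtain ⟨d, hd, e⟩ := hπ u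
    refine hX.eq_of_eq_smul hf (c := d⁻¹ * c) ?_
    rw [mul_smul, ← hc, e, inv_smul_smul₀ hd]
  have hsurj : Function.Surjective π := fun q => by
    obtain ⟨u, hu, c, -, e⟩ := hX.exists_mem_specialCover q
    exact ⟨⟨u, hu⟩, hπeq ⟨u, hu⟩ q c e⟩
  -- Invariant subspaces of lifts of `K` are invariant under `K`.
  have hlift : ∀ (W : Submodule ℂ V) (u : Γ),
      (∀ w ∈ W, ((u : (Module.End ℂ V)ˣ) : Module.End ℂ V) w ∈ W) → ∀ w ∈ W, X (π u) w ∈ W := by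
    intro W u hu w hw
    obtain ⟨c, hc, e⟩ := hπ u
    have := W.smul_mem c⁻¹ (hu w hw)
    rwa [e, LinearMap.smul_apply, inv_smul_smul₀ hc] at this
  have hcent : ∀ x : Q, (∀ k ∈ K, k * x = x * k) → x = 1 := fun x hx =>
    hf x (hirr.schur fun k => hX.commute_of_perfect hperf hx k k.2)
  have hker : Subgroup.center Γ = π.ker := by
    ext z
    rw [Subgroup.mem_center_iff, MonoidHom.mem_ker]
    refine ⟨fun hz => hcent _ fun k hk => ?_, fun hz u => ?_⟩
    · obtain ⟨u, rfl⟩ := hsurj k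
      rw [← map_mul, ← map_mul, hz]
    · obtain ⟨c, hc, e⟩ := hπ z
      obtain ⟨d, hd, e1⟩ := hX.one
      rw [hz, e1, smul_smul] at e
      refine Subtype.ext (Units.ext ?_)
      rw [Subgroup.coe_mul, Subgroup.coe_mul, Units.val_mul, Units.val_mul, e, mul_smul_comm,
        smul_mul_assoc, mul_one, one_mul]
  let e : Γ ⧸ Subgroup.center Γ ≃* Q :=
    (QuotientGroup.quotientMulEquivOfEq hker).trans
      (QuotientGroup.quotientKerEquivOfSurjective π hsurj)
  have he : ∀ u : Γ, e (u : Γ ⧸ Subgroup.center Γ) = π u := fun u => rfl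
  let ρ : Representation ℂ Γ V := (Units.coeHom (Module.End ℂ V)).comp Γ.subtype
  have hρ : ∀ u : Γ, ρ u = ((u : (Module.End ℂ V)ˣ) : Module.End ℂ V) := fun u => rfl
  have hρirr : ActsIrred ρ := hirr.of_forall_invariant fun W hW k => by
    obtain ⟨u, hu⟩ := hsurj k
    rw [← hu]
    exact hlift W u (hW u)
  have hres : K ≤ (solvableResidual Γ).map π := by
    obtain ⟨n, hn⟩ := exists_solvableResidual_eq Γ
    rw [hn, map_derivedSeries_eq hsurj]
    exact le_derivedSeries_of_perfect hperf n
  have hresirr : ActsIrred (ρ.comp (solvableResidual Γ).subtype) :=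
    hirr.of_forall_invariant fun W hW k => by
      obtain ⟨u, hu, hk⟩ := hres k.2
      rw [← hk]
      exact hlift W u (hW ⟨u, hu⟩)
  obtain ⟨g, rfl⟩ := hsurj h
  have hg : ρ.character g ≠ 0 := by
    obtain ⟨c, hc, eg⟩ := hπ g
    change LinearMap.trace ℂ V (ρ g) ≠ 0
    rw [hρ, eg, map_smul]
    exact smul_ne_zero hc htr
  obtain ⟨k, hk⟩ := hconj Γ (isAlmostSimple_of_mulEquiv e K hK hcent) ρ.character
    (isIrrChar_of_actsIrred ρ hρirr) (by
      intro u hu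
      rw [Representation.char_one] at hu
      have := eq_one_of_trace_eq_finrank (f := ρ u) (n := Nat.card Γ) Nat.card_pos.ne'
        (by rw [← map_pow, pow_card_eq_one', map_one]) hu
      exact Subtype.ext (Units.ext this))
    (isIrrChar_of_actsIrred (ρ.comp (solvableResidual Γ).subtype) hresirr) g hg (by
      set S := solvableResidual Γ ⊔ Subgroup.center Γ ⊔ Subgroup.zpowers g with hS
      have h1 : π.ker ≤ S := by
        rw [← hker]
        exact le_sup_right.trans le_sup_left
      rw [← Subgroup.comap_map_eq_self h1]
      have h2 : S.map π = ⊤ := by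
        rw [eq_top_iff, ← hgen]
        refine sup_le (hres.trans (Subgroup.map_mono (le_sup_left.trans le_sup_left))) ?_
        rw [Subgroup.zpowers_le]
        exact ⟨g, (le_sup_right : Subgroup.zpowers g ≤ S) (Subgroup.mem_zpowers g), rfl⟩
      rw [h2, Subgroup.comap_top])
  rw [Representation.char_one, ← MulEquiv.orderOf_eq e, he,
    show (Subgroup.center Γ).index = Nat.card Q from Nat.card_congr e.toEquiv] at hk
  have hd : (finrank ℂ V : ℂ) ≠ 0 := by
    exact_mod_cast (finrank_pos (R := ℂ) (M := V)).ne'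
  rw [div_eq_iff hd] at hk
  have h3 : (Nat.card Q : ℤ) = ((orderOf (π g) * finrank ℂ V : ℕ) : ℤ) * k := by
    have : ((Nat.card Q : ℤ) : ℂ) = ((((orderOf (π g) * finrank ℂ V : ℕ) : ℤ) * k : ℤ) : ℂ) := by
      push_cast
      rw [hk]
      ring
    exact_mod_cast this
  exact Int.natCast_dvd_natCast.1 ⟨k, h3⟩

/-! ### Orders of elements and minimal normal subgroups -/

section groups

variable {Q : Type*} [Group Q]

theorem orderOf_dvd_orderOf_mk_mul (N : Subgroup Q) [N.Normal] (g : Q) {e : ℕ}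
    (h : (g ^ orderOf (g : Q ⧸ N)) ^ e = 1) : orderOf g ∣ orderOf (g : Q ⧸ N) * e := by
  rw [orderOf_dvd_iff_pow_eq_one, pow_mul, h]

theorem pow_orderOf_mk_mem (N : Subgroup Q) [N.Normal] (g : Q) :
    g ^ orderOf (g : Q ⧸ N) ∈ N := by
  rw [← QuotientGroup.eq_one_iff, QuotientGroup.mk_pow, pow_orderOf_eq_one]

theorem orderOf_mk_dvd_iff (N : Subgroup Q) [N.Normal] {g : Q} {n : ℕ} :
    orderOf (g : Q ⧸ N) ∣ n ↔ g ^ n ∈ N := by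
  rw [orderOf_dvd_iff_pow_eq_one, ← QuotientGroup.mk_pow, QuotientGroup.eq_one_iff]

theorem pow_card_eq_one_of_mem (N : Subgroup Q) [Finite N] {g : Q} (h : g ∈ N) :
    g ^ Nat.card N = 1 := by
  have := pow_card_eq_one' (x := (⟨g, h⟩ : N))
  exact congrArg Subtype.val this

theorem card_sup_zpowers [Finite Q] (N : Subgroup Q) [N.Normal] (g : Q) :
    Nat.card (N ⊔ Subgroup.zpowers g : Subgroup Q) = orderOf (g : Q ⧸ N) * Nat.card N := by
  set H := N ⊔ Subgroup.zpowers g with hH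
  have h1 : H = (Subgroup.zpowers (g : Q ⧸ N)).comap (QuotientGroup.mk' N) := by
    have hk : (QuotientGroup.mk' N).ker ≤ H := by
      rw [QuotientGroup.ker_mk']
      exact le_sup_left
    rw [← Subgroup.comap_map_eq_self hk, hH, Subgroup.map_sup, QuotientGroup.map_mk'_self,
      bot_sup_eq, MonoidHom.map_zpowers]
    rfl
  have h2 : H.index = (Subgroup.zpowers (g : Q ⧸ N)).index := by
    rw [h1, Subgroup.index_comap_of_surjective _ (QuotientGroup.mk'_surjective N)]
  have h3 := H.card_mul_index
  have h4 := (Subgroup.zpowers (g : Q ⧸ N)).card_mul_index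
  rw [Subgroup.card_eq_card_quotient_mul_card_subgroup N, ← h4, h2, Nat.card_zpowers,
    mul_right_comm] at h3
  exact Nat.eq_of_mul_eq_mul_right (Nat.pos_of_ne_zero Subgroup.FiniteIndex.index_ne_zero) h3

theorem card_lt_of_ne_top [Finite Q] {H : Subgroup Q} (h : H ≠ ⊤) : Nat.card H < Nat.card Q :=
  lt_of_le_of_ne (Subgroup.card_le_card_group H) fun h' => h (Subgroup.eq_top_of_card_eq H h')

theorem card_quotient_lt_of_ne_bot [Finite Q] {N : Subgroup Q} (h : N ≠ ⊥) :
    Nat.card (Q ⧸ N) < Nat.card Q := by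
  rw [Subgroup.card_eq_card_quotient_mul_card_subgroup N]
  refine lt_mul_of_one_lt_right Nat.card_pos ?_
  by_contra hlt
  exact h (Subgroup.eq_bot_of_card_le N (not_lt.1 hlt))

/-- Among the nontrivial subgroups with a given property there is a minimal one. -/
theorem exists_minimal_subgroup [Finite Q] (P : Subgroup Q → Prop) {H : Subgroup Q} (hH : P H)
    (hH' : H ≠ ⊥) : ∃ K, P K ∧ K ≠ ⊥ ∧ ∀ L ≤ K, P L → L ≠ ⊥ → L = K := by
  obtain ⟨K, hK⟩ := (Set.toFinite {K : Subgroup Q | P K ∧ K ≠ ⊥}).exists_minimal ⟨H, hH, hH'⟩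
  exact ⟨K, hK.prop.1, hK.prop.2, fun L hL h1 h2 => hK.eq_of_le ⟨h1, h2⟩ hL⟩

/-- If `u ^ i * v * u⁻ⁱ` commutes with `uᵐ * v * u⁻ᵐ` for `0 < i < m`, then `u` is conjugate to
`v * uᵐ * v⁻¹ * u⁻ᵐ * u`: conjugate by the product of the `uⁱ * v * u⁻ⁱ` with `i < m`. -/
theorem exists_conj_eq_of_commute (u v : Q) {m : ℕ} (hm : m ≠ 0)
    (h : ∀ i, 0 < i → i < m → Commute (u ^ i * v * (u ^ i)⁻¹) (u ^ m * v * (u ^ m)⁻¹)) :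
    ∃ p, p * u * p⁻¹ = v * u ^ m * v⁻¹ * (u ^ m)⁻¹ * u := by
  set z := u ^ m * v * (u ^ m)⁻¹ with hz
  obtain ⟨n, rfl⟩ := Nat.exists_eq_succ_of_ne_zero hm
  let P : ℕ → Q := fun k => (v * u) ^ k * (u ^ k)⁻¹
  have hP : ∀ k, P (k + 1) = P k * (u ^ k * v * (u ^ k)⁻¹) := by
    intro k
    simp only [P, pow_succ]
    group
  have hP' : ∀ k, P (k + 1) = v * (u * P k * u⁻¹) := by
    intro k
    simp only [P, pow_succ' (v * u), pow_succ u]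
    group
  have hcomm : ∀ k, k < n + 1 → Commute (u * P k * u⁻¹) z := by
    intro k
    induction k with
    | zero => intro _; simp [P]
    | succ k ih =>
      intro hk
      have e : u * P (k + 1) * u⁻¹ =
          (u * P k * u⁻¹) * (u ^ (k + 1) * v * (u ^ (k + 1))⁻¹) := by
        rw [hP, pow_succ' u]
        group
      rw [e]
      exact (ih (by omega)).mul_left (h (k + 1) (by omega) hk)
  refine ⟨P (n + 1), ?_⟩
  have h1 : u * P (n + 1) * u⁻¹ = z * (u * P n * u⁻¹) := by
    rw [← (hcomm n (by omega)).eq, hP, hz, pow_succ' u]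
    group
  have h2 : P (n + 1) * u * (P (n + 1))⁻¹ = P (n + 1) * (u * P (n + 1) * u⁻¹)⁻¹ * u := by
    group
  rw [h2, h1, hP', hz, Nat.succ_eq_add_one]
  group

end groups

/-! ### Descending to quotients -/

namespace IsProjRep

variable {Q V : Type*} [Group Q] [AddCommGroup V] [Module ℂ V] {X : Q → Module.End ℂ V}

theorem mk_out_eq_smul (hX : IsProjRep X) (N : Subgroup Q)
    (hN : ∀ n ∈ N, ∃ c : ℂ, c ≠ 0 ∧ X n = c • 1) (g : Q) :
    ∃ c : ℂ, c ≠ 0 ∧ X (g : Q ⧸ N).out = c • X g := by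
  obtain ⟨n, hn⟩ := QuotientGroup.mk_out_eq_mul N g
  obtain ⟨c, hc, e⟩ := hX.mul g n
  obtain ⟨d, hd, e'⟩ := hN n n.2
  exact ⟨c * d, mul_ne_zero hc hd, by rw [hn, e, e', mul_smul_comm, mul_one, smul_smul]⟩

/-- A projective representation that is scalar on a normal subgroup descends to the quotient. -/
theorem quotient (hX : IsProjRep X) (N : Subgroup Q) [N.Normal]
    (hN : ∀ n ∈ N, ∃ c : ℂ, c ≠ 0 ∧ X n = c • 1) : IsProjRep fun q : Q ⧸ N => X q.out := by
  refine ⟨?_, fun q r => ?_⟩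
  · obtain ⟨c, hc, e⟩ := hX.mk_out_eq_smul N hN 1
    obtain ⟨d, hd, e'⟩ := hX.one
    exact ⟨c * d, mul_ne_zero hc hd, by rw [mul_smul, ← e', ← e]; rfl⟩
  · obtain ⟨c, hc, e⟩ := hX.mk_out_eq_smul N hN (q.out * r.out)
    obtain ⟨d, hd, e'⟩ := hX.mul q.out r.out
    refine ⟨c * d, mul_ne_zero hc hd, ?_⟩
    rw [mul_smul, ← e', ← e, QuotientGroup.mk_mul, QuotientGroup.out_eq', QuotientGroup.out_eq']

theorem actsIrred_quotient (hX : IsProjRep X) (hirr : ActsIrred X) (N : Subgroup Q)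
    (hN : ∀ n ∈ N, ∃ c : ℂ, c ≠ 0 ∧ X n = c • 1) : ActsIrred fun q : Q ⧸ N => X q.out :=
  hirr.of_forall_invariant fun W hW g w hw => by
    obtain ⟨c, hc, e⟩ := hX.mk_out_eq_smul N hN g
    have := W.smul_mem c⁻¹ (hW (g : Q ⧸ N) w hw)
    rwa [e, LinearMap.smul_apply, inv_smul_smul₀ hc] at this

theorem trace_mk_out_ne_zero (hX : IsProjRep X) (N : Subgroup Q)
    (hN : ∀ n ∈ N, ∃ c : ℂ, c ≠ 0 ∧ X n = c • 1) {g : Q} (hg : LinearMap.trace ℂ V (X g) ≠ 0) :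
    LinearMap.trace ℂ V (X (g : Q ⧸ N).out) ≠ 0 := by
  obtain ⟨c, hc, e⟩ := hX.mk_out_eq_smul N hN g
  rw [e, map_smul]
  exact smul_ne_zero hc hg

theorem exists_ne_zero_smul_one [Nontrivial V] (hX : IsProjRep X) {g : Q} {c : ℂ}
    (h : X g = c • 1) : c ≠ 0 := by
  rintro rfl
  exact hX.ne_zero g (by rw [h, zero_smul])

/-- The normal subgroup of the elements that act by scalars. -/
def scalarKernel (hX : IsProjRep X) : Subgroup Q where
  carrier := {g | ∃ c : ℂ, c ≠ 0 ∧ X g = c • 1}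
  one_mem' := hX.one
  mul_mem' := by
    rintro g h ⟨c, hc, e⟩ ⟨d, hd, e'⟩
    obtain ⟨k, hk, ek⟩ := hX.mul g h
    exact ⟨k * (c * d), mul_ne_zero hk (mul_ne_zero hc hd), by
      rw [ek, e, e', smul_mul_smul_comm, mul_one, smul_smul]⟩
  inv_mem' := by
    rintro g ⟨c, hc, e⟩
    obtain ⟨k, hk, ek⟩ := hX.mul g g⁻¹
    obtain ⟨d, hd, ed⟩ := hX.one
    rw [mul_inv_cancel, ed, e, smul_mul_assoc, one_mul, smul_smul] at ek
    refine ⟨(k * c)⁻¹ * d, mul_ne_zero (inv_ne_zero (mul_ne_zero hk hc)) hd, ?_⟩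
    rw [mul_smul, ek, inv_smul_smul₀ (mul_ne_zero hk hc)]

instance (hX : IsProjRep X) : hX.scalarKernel.Normal := by
  refine ⟨?_⟩
  rintro n ⟨c, hc, e⟩ g
  obtain ⟨k, hk, ek⟩ := hX.conj_apply_self g n
  have h1 : hX.conj g (c • 1) = c • 1 := by
    rw [map_smul]
    congr 1
    symm
    rw [eq_conj_iff, one_mul, mul_one]
  rw [e, h1] at ek
  exact ⟨k⁻¹ * c, mul_ne_zero (inv_ne_zero hk) hc, by rw [mul_smul, ek, inv_smul_smul₀ hk]⟩

theorem faithful_of_scalarKernel_eq_bot [Nontrivial V] (hX : IsProjRep X)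
    (h : hX.scalarKernel = ⊥) : Faithful X := by
  rintro q ⟨c, hc⟩
  have : q ∈ hX.scalarKernel := ⟨c, hX.exists_ne_zero_smul_one hc, hc⟩
  rwa [h, Subgroup.mem_bot] at this

theorem trace_one_ne_zero [FiniteDimensional ℂ V] [Nontrivial V] (hX : IsProjRep X) :
    LinearMap.trace ℂ V (X 1) ≠ 0 := by
  obtain ⟨c, hc, e⟩ := hX.one
  rw [e, map_smul, LinearMap.trace_one]
  refine smul_ne_zero hc ?_
  exact_mod_cast (finrank_pos (R := ℂ) (M := V)).ne'

theorem pow_eq_smul (hX : IsProjRep X) (g : Q) (n : ℕ) :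
    ∃ c : ℂ, c ≠ 0 ∧ X (g ^ n) = c • X g ^ n := by
  induction n with
  | zero => simpa using hX.one
  | succ n ih =>
    obtain ⟨c, hc, e⟩ := ih
    obtain ⟨d, hd, e'⟩ := hX.mul (g ^ n) g
    exact ⟨d * c, mul_ne_zero hd hc, by
      rw [pow_succ, e', e, smul_mul_assoc, smul_smul, pow_succ]⟩

/-- A subspace invariant under two subgroups is invariant under the subgroup they generate. -/
theorem invariant_of_mem_sup [FiniteDimensional ℂ V] (hX : IsProjRep X) {W : Submodule ℂ V}
    {H K : Subgroup Q}
    (hH : ∀ g ∈ H, ∀ w ∈ W, X g w ∈ W) (hK : ∀ g ∈ K, ∀ w ∈ W, X g w ∈ W) :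
    ∀ g ∈ H ⊔ K, ∀ w ∈ W, X g w ∈ W := by
  let := hX.mulAction
  have key : ∀ g, (∀ w ∈ W, X g w ∈ W) → g ∈ MulAction.stabilizer Q W := by
    intro g hg
    rw [MulAction.mem_stabilizer_iff]
    change W.map (X g) = W
    refine Submodule.eq_of_le_of_finrank_eq ?_ ?_
    · rintro _ ⟨w, hw, rfl⟩
      exact hg w hw
    · exact (LinearEquiv.finrank_eq (Submodule.equivMapOfInjective _ (hX.injective g) W)).symm
  have hle : H ⊔ K ≤ MulAction.stabilizer Q W :=
    sup_le (fun g hg => key g (hH g hg)) (fun g hg => key g (hK g hg))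
  intro g hg w hw
  have h1 : W.map (X g) = W := MulAction.mem_stabilizer_iff.1 (hle hg)
  rw [← h1]
  exact ⟨w, hw, rfl⟩

end IsProjRep

theorem ActsIrred.finrank_eq_one {ι V : Type*} [AddCommGroup V] [Module ℂ V]
    {X : ι → Module.End ℂ V} (hirr : ActsIrred X) (h : ∀ i, ∃ c : ℂ, X i = c • 1) :
    finrank ℂ V = 1 := by
  have := hirr.nontrivial
  obtain ⟨v, hv⟩ := exists_ne (0 : V)
  have h1 := (hirr.eq_bot_or_eq_top (ℂ ∙ v) fun i w hw => by
    obtain ⟨c, e⟩ := h i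
    rw [e]
    exact Submodule.smul_mem _ _ hw).resolve_left (by simpa using hv)
  rw [← finrank_top ℂ V, ← h1, finrank_span_singleton hv]

/-- Every family of operators has a minimal nonzero invariant subspace. -/
theorem exists_actsIrred_restrict {ι V : Type*} [AddCommGroup V] [Module ℂ V]
    [FiniteDimensional ℂ V] [Nontrivial V] (X : ι → Module.End ℂ V) :
    ∃ (U : Submodule ℂ V) (hU : ∀ i, ∀ u ∈ U, X i u ∈ U),
      ActsIrred fun i => (X i).restrict (hU i) := by
  obtain ⟨U, ⟨hU0, hU⟩, hmin⟩ := wellFounded_lt.has_min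
    {U : Submodule ℂ V | U ≠ ⊥ ∧ ∀ i, ∀ u ∈ U, X i u ∈ U} ⟨⊤, top_ne_bot, fun _ _ _ => trivial⟩
  refine ⟨U, hU, Submodule.nontrivial_iff_ne_bot.2 hU0, fun W hW => ?_⟩
  by_cases h0 : W = ⊥
  · exact Or.inl h0
  · right
    have hinj : Function.Injective (Submodule.map U.subtype) :=
      Submodule.map_injective_of_injective U.subtype_injective
    apply hinj
    rw [Submodule.map_top, Submodule.range_subtype]
    by_contra hne
    refine hmin (W.map U.subtype) ⟨fun h => h0 (hinj (h.trans (Submodule.map_bot _).symm)), ?_⟩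
      (lt_of_le_of_ne (Submodule.map_subtype_le U W) hne)
    rintro i _ ⟨w, hw, rfl⟩
    exact ⟨_, hW i w hw, rfl⟩

/-! ### Non-abelian minimal normal subgroups -/

section minimalNormal

variable {Q : Type*} [Group Q] [Finite Q]

/-- A non-abelian minimal normal subgroup `M` is generated by the conjugates of a non-abelian simple
subgroup `K` that is normal in `M` and commutes with each of its other conjugates. -/
theorem exists_simple_of_minimal_normal (M : Subgroup Q) [M.Normal] (hM : M ≠ ⊥)
    (hmin : ∀ L ≤ M, L.Normal → L ≠ ⊥ → L = M) (hne : ∃ a ∈ M, ∃ b ∈ M, a * b ≠ b * a) :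
    ∃ K : Subgroup Q, IsSimpleGroup K ∧ (∃ a ∈ K, ∃ b ∈ K, a * b ≠ b * a) ∧ K ≤ M ∧
      M ≤ Subgroup.normalizer (K : Set Q) ∧ Subgroup.normalClosure (K : Set Q) = M ∧
      M ≤ K ⊔ Subgroup.centralizer (K : Set Q) ∧
      ∀ q ∉ Subgroup.normalizer (K : Set Q), ∀ k ∈ K,
        q * k * q⁻¹ ∈ Subgroup.centralizer (K : Set Q) := by
  obtain ⟨K, ⟨hKM, hKn⟩, hK0, hKmin⟩ := exists_minimal_subgroup
    (fun K : Subgroup Q => K ≤ M ∧ ∀ m ∈ M, ∀ k ∈ K, m * k * m⁻¹ ∈ K) (H := M)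
    ⟨le_rfl, fun m hm k hk => M.mul_mem (M.mul_mem hm hk) (M.inv_mem hm)⟩ hM
  have hMn : ∀ q : Q, ∀ m ∈ M, q * m * q⁻¹ ∈ M := fun q m hm =>
    Subgroup.Normal.conj_mem ‹_› m hm q
  have hMT : M ≤ Subgroup.normalizer (K : Set Q) := by
    intro m hm
    rw [Subgroup.mem_normalizer_iff]
    refine fun k => ⟨hKn m hm k, fun hk => ?_⟩
    have := hKn _ (M.inv_mem hm) _ hk
    rwa [show m⁻¹ * (m * k * m⁻¹) * m⁻¹⁻¹ = k by group] at this
  have hncl : Subgroup.normalClosure (K : Set Q) = M := by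
    refine hmin _ (Subgroup.normalClosure_le_normal hKM) inferInstance fun h => hK0 ?_
    rw [eq_bot_iff, ← h]
    exact Subgroup.subset_normalClosure
  have hcomm : ∀ q ∉ Subgroup.normalizer (K : Set Q), ∀ k ∈ K,
      q * k * q⁻¹ ∈ Subgroup.centralizer (K : Set Q) := by
    intro q hq
    let K' := K.map (MulAut.conj q).toMonoidHom
    have hK'M : ∀ x ∈ K', x ∈ M := by
      rintro _ ⟨k, hk, rfl⟩
      exact hMn q k (hKM hk)
    have hK'n : ∀ m ∈ M, ∀ x ∈ K', m * x * m⁻¹ ∈ K' := by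
      rintro m hm _ ⟨k, hk, rfl⟩
      refine ⟨(q⁻¹ * m * q) * k * (q⁻¹ * m * q)⁻¹, hKn _ ?_ k hk, ?_⟩
      · have := hMn q⁻¹ m hm
        rwa [inv_inv] at this
      · simp only [MulEquiv.coe_toMonoidHom, MulAut.conj_apply]
        group
    have hbot : K ⊓ K' = ⊥ := by
      by_contra h
      have h1 := hKmin (K ⊓ K') inf_le_left ⟨inf_le_left.trans hKM, fun m hm k hk =>
        ⟨hKn m hm k hk.1, hK'n m hm k hk.2⟩⟩ h
      have h2 : K ≤ K' := inf_eq_left.1 h1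
      have h3 : K' = K := by
        refine (Subgroup.eq_of_le_of_card_ge h2 ?_).symm
        exact (Subgroup.card_map_of_injective (MulAut.conj q).injective).le
      exact hq (Subgroup.mem_normalizer_iff_map_conj_eq.2 h3)
    intro k hk
    rw [Subgroup.mem_centralizer_iff]
    intro l hl
    have hy : q * k * q⁻¹ ∈ K' := ⟨k, hk, rfl⟩
    have h1 : l * (q * k * q⁻¹) * l⁻¹ * (q * k * q⁻¹)⁻¹ ∈ K ⊓ K' := by
      have h2 : l * (q * k * q⁻¹) * l⁻¹ * (q * k * q⁻¹)⁻¹ ∈ K := by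
        have := K.mul_mem hl (hKn _ (hK'M _ hy) _ (K.inv_mem hl))
        simpa only [mul_assoc] using this
      exact ⟨h2, K'.mul_mem (hK'n l (hKM hl) _ hy) (K'.inv_mem hy)⟩
    rw [hbot, Subgroup.mem_bot, mul_inv_eq_one, mul_inv_eq_iff_eq_mul] at h1
    exact h1
  have hMKC : M ≤ K ⊔ Subgroup.centralizer (K : Set Q) := by
    rw [← hncl, Subgroup.normalClosure, Subgroup.closure_le]
    intro x hx
    obtain ⟨k, hk, hx⟩ := Group.mem_conjugatesOfSet_iff.1 hx
    obtain ⟨q, rfl⟩ := isConj_iff.1 hx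
    by_cases hq : q ∈ Subgroup.normalizer (K : Set Q)
    · exact (le_sup_left : K ≤ _) ((Subgroup.mem_normalizer_iff.1 hq k).1 hk)
    · exact (le_sup_right : Subgroup.centralizer (K : Set Q) ≤ _) (hcomm q hq k hk)
  have hKne : ∃ a ∈ K, ∃ b ∈ K, a * b ≠ b * a := by
    by_contra! hab
    have h1 : K ≤ Subgroup.centralizer (K : Set Q) := fun a ha =>
      Subgroup.mem_centralizer_iff.2 fun b hb => hab b hb a ha
    have h2 : M ≤ Subgroup.centralizer (K : Set Q) := hMKC.trans (sup_le h1 le_rfl)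
    have h3 : M ≤ Subgroup.centralizer (M : Set Q) := by
      nth_rewrite 1 [← hncl]
      refine Subgroup.normalClosure_le_normal fun k hk => ?_
      exact Subgroup.mem_centralizer_iff.2 fun m hm =>
        (Subgroup.mem_centralizer_iff.1 (h2 hm) k hk).symm
    obtain ⟨a, ha, b, hb, h⟩ := hne
    exact h (Subgroup.mem_centralizer_iff.1 (h3 hb) a ha)
  refine ⟨K, ?_, hKne, hKM, hMT, hncl, hMKC, hcomm⟩
  have : Nontrivial K := (Subgroup.nontrivial_iff_ne_bot K).2 hK0
  refine { eq_bot_or_eq_top_of_normal := fun L hL => ?_ }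
  by_cases h0 : L = ⊥
  · exact Or.inl h0
  right
  have hinj := Subgroup.map_injective K.subtype_injective
  apply hinj
  rw [← MonoidHom.range_eq_map, Subgroup.range_subtype]
  have hLK : L.map K.subtype ≤ K := by
    rintro _ ⟨l, -, rfl⟩
    exact l.2
  have hnorm : K ⊔ Subgroup.centralizer (K : Set Q) ≤
      Subgroup.normalizer (L.map K.subtype : Set Q) := by
    refine sup_le (fun k hk => ?_) (fun c hc => ?_)
    · refine Subgroup.mem_normalizer_fintype ?_
      rintro _ ⟨l, hl, rfl⟩
      exact ⟨⟨k, hk⟩ * l * ⟨k, hk⟩⁻¹, hL.conj_mem l hl ⟨k, hk⟩, rfl⟩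
    · refine Subgroup.mem_normalizer_fintype ?_
      intro x hx
      have := Subgroup.mem_centralizer_iff.1 hc x (hLK hx)
      rw [← this, mul_inv_cancel_right]
      exact hx
  refine hKmin _ hLK ⟨hLK.trans hKM, fun m hm k hk => ?_⟩ fun h => h0 (hinj (by
    rw [h, Subgroup.map_bot]))
  exact (Subgroup.mem_normalizer_iff.1 (hnorm (hMKC hm)) k).1 hk

end minimalNormal

/-! ### The divisibility for projective representations -/

/-- The statement for projective representations of groups of order `n`: if `X` is an irreducible
projective representation of `Q` and `X g` has nonzero trace, then the order of `g` times the degree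
of `X` divides the order of `Q`. -/
def OrderMulDegreeDvd.{u} (n : ℕ) : Prop :=
  ∀ (Q : Type u) [Group Q] [Finite Q], Nat.card Q = n → ∀ (V : Type) [AddCommGroup V] [Module ℂ V]
    [FiniteDimensional ℂ V] (X : Q → Module.End ℂ V), IsProjRep X → ActsIrred X →
    ∀ g, LinearMap.trace ℂ V (X g) ≠ 0 → orderOf g * finrank ℂ V ∣ Nat.card Q

section induction

universe u

variable {Q : Type u} [Group Q] [Finite Q] {V : Type} [AddCommGroup V] [Module ℂ V]
  [FiniteDimensional ℂ V] {X : Q → Module.End ℂ V}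

theorem orderOf_mk_mul_finrank_dvd (N : Subgroup Q) [N.Normal]
    (ih : OrderMulDegreeDvd.{u} (Nat.card (Q ⧸ N)))
    (hX : IsProjRep X) (hirr : ActsIrred X)
    (hN : ∀ n ∈ N, ∃ c : ℂ, c ≠ 0 ∧ X n = c • 1) {g : Q} (htr : LinearMap.trace ℂ V (X g) ≠ 0) :
    orderOf (g : Q ⧸ N) * finrank ℂ V ∣ Nat.card (Q ⧸ N) :=
  ih (Q ⧸ N) rfl V _ (hX.quotient N hN) (hX.actsIrred_quotient hirr N hN) g
    (hX.trace_mk_out_ne_zero N hN htr)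

/-- The scalar kernel `N` can be factored out, as `orderOf g` divides
`orderOf (g : Q ⧸ N) * |N|`. -/
theorem orderOf_mul_finrank_dvd_of_scalarKernel_ne_bot
    (ih : ∀ n < Nat.card Q, OrderMulDegreeDvd.{u} n) (hX : IsProjRep X) (hirr : ActsIrred X)
    (h : hX.scalarKernel ≠ ⊥) {g : Q} (htr : LinearMap.trace ℂ V (X g) ≠ 0) :
    orderOf g * finrank ℂ V ∣ Nat.card Q := by
  have h1 := orderOf_mk_mul_finrank_dvd hX.scalarKernel
    (ih _ (card_quotient_lt_of_ne_bot h)) hX hirr (fun n hn => hn) htr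
  have h2 := orderOf_dvd_orderOf_mk_mul hX.scalarKernel g
    (pow_card_eq_one_of_mem _ (pow_orderOf_mk_mem _ g))
  rw [Subgroup.card_eq_card_quotient_mul_card_subgroup hX.scalarKernel]
  refine (Nat.mul_dvd_mul_right h2 _).trans ?_
  rw [mul_right_comm]
  exact Nat.mul_dvd_mul_right h1 _

/-- An abelian subgroup `M` on which a faithful projective representation is irreducible of degree
`d` has order `d ^ 2` and exponent dividing `d`. -/
theorem card_eq_sq_of_abelian (hX : IsProjRep X) (hf : IsProjRep.Faithful X) (M : Subgroup Q)
    (hirr : ActsIrred fun m : M => X m) (hab : ∀ a ∈ M, ∀ b ∈ M, a * b = b * a) :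
    Nat.card M = finrank ℂ V * finrank ℂ V ∧ ∀ m ∈ M, m ^ finrank ℂ V = 1 := by
  have := hirr.nontrivial
  have hd : finrank ℂ V ≠ 0 := (finrank_pos (R := ℂ) (M := V)).ne'
  have hconj : ∀ x ∈ M, ∀ m ∈ M, ∃ c : ℂ, hX.conj x (X m) = c • X m := by
    intro x hx m hm
    obtain ⟨c, -, e⟩ := hX.conj_apply_self x m
    rw [hab x hx m hm, mul_inv_cancel_right] at e
    exact ⟨c, e⟩
  refine ⟨?_, fun m hm => ?_⟩
  · -- Compare traces in the rank-one formula: all but one of the traces vanish.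
    have htr0 : ∀ m ∈ M, m ≠ 1 → LinearMap.trace ℂ V (X m) = 0 := by
      intro m hm hm1
      by_contra htr
      refine hm1 (hf m (hirr.schur fun x => ?_))
      obtain ⟨c, e⟩ := hconj x x.2 m hm
      have h1 := hX.trace_conj (x : Q) (X m)
      rw [e, map_smul, smul_eq_mul] at h1
      rw [(mul_eq_right₀ htr).1 h1, one_smul] at e
      exact hX.conj_eq_self_iff.1 e
    have := Fintype.ofFinite M
    obtain ⟨v, hv⟩ := exists_ne (0 : V)
    obtain ⟨φ, hφ⟩ := exists_functional_eq_one hv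
    have h := congrArg (LinearMap.trace ℂ V) ((hX.subgroup M).sum_smul_eq hirr φ v)
    rw [map_sum, Finset.sum_eq_single (1 : M)] at h
    · obtain ⟨c, hc, e⟩ := hX.one
      have h1 := LinearMap.congr_fun ((hX.subgroup M).inv_mul_self 1) v
      have e' : X ((1 : M) : Q) = c • 1 := e
      rw [Module.End.mul_apply, e', Module.End.one_apply, LinearMap.smul_apply,
        Module.End.one_apply, map_smul] at h1
      have h2 := congrArg φ h1
      rw [map_smul, hφ, smul_eq_mul, mul_comm] at h2
      rw [e', map_smul, map_smul, smul_smul, h2, one_smul, LinearMap.trace_one, map_smul,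
        LinearMap.trace_smulRight, hφ, smul_eq_mul, mul_one] at h
      rw [eq_div_iff (by exact_mod_cast hd)] at h
      rw [Nat.card_eq_fintype_card]
      exact_mod_cast h.symm
    · intro m _ hm
      rw [map_smul, htr0 m m.2 (fun h => hm (Subtype.ext h)), smul_zero]
    · intro h; exact absurd (Finset.mem_univ _) h
  · -- The scalars by which `X x` and `X m` commute have order dividing the degree, by determinants.
    refine hf _ ?_
    obtain ⟨k, -, ek⟩ := hX.pow_eq_smul m (finrank ℂ V)
    obtain ⟨l, hl⟩ := hirr.schur (T := X m ^ finrank ℂ V) fun x => by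
      obtain ⟨c, e⟩ := hconj x x.2 m hm
      have hdet : LinearMap.det (X m) ≠ 0 := by
        have := (hX.unit m).isUnit.map (LinearMap.det (A := ℂ) (M := V))
        rw [hX.unit_val] at this
        exact this.ne_zero
      have hdet' : LinearMap.det (X (x : Q)) ≠ 0 := by
        have := (hX.unit (x : Q)).isUnit.map (LinearMap.det (A := ℂ) (M := V))
        rw [hX.unit_val] at this
        exact this.ne_zero
      have h1 := hX.conj_mul_self (x : Q) (X m)
      have h2 := congrArg LinearMap.det h1
      rw [e, map_mul, map_mul, LinearMap.det_smul] at h2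
      have h3 : c ^ finrank ℂ V = 1 := by
        have : (c ^ finrank ℂ V - 1) * (LinearMap.det (X m) * LinearMap.det (X (x : Q))) = 0 := by
          linear_combination h2
        exact sub_eq_zero.1 ((mul_eq_zero.1 this).resolve_right (mul_ne_zero hdet hdet'))
      have h4 : ∀ j : ℕ, hX.conj x (X m ^ j) = c ^ j • X m ^ j := by
        intro j
        induction j with
        | zero =>
          rw [pow_zero, pow_zero, one_smul]
          symm
          rw [hX.eq_conj_iff, one_mul, mul_one]
        | succ j ihj =>
          rw [pow_succ, hX.conj_apply_mul, ihj, e, smul_mul_smul_comm, pow_succ]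
      have h5 := h4 (finrank ℂ V)
      rw [h3, one_smul] at h5
      exact hX.conj_eq_self_iff.1 h5
    exact ⟨k * l, by rw [ek, hl, smul_smul]⟩

end induction

/-! ### Cyclic extensions of minimal normal subgroups -/

/-- A perfect subgroup on which a faithful projective representation is irreducible has trivial
centralizer. -/
theorem eq_one_of_faithful_of_perfect {Q V : Type*} [Group Q] [AddCommGroup V] [Module ℂ V]
    [FiniteDimensional ℂ V] {X : Q → Module.End ℂ V} (hX : IsProjRep X)
    (hf : IsProjRep.Faithful X) {M : Subgroup Q} (hM : ⁅M, M⁆ = M)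
    (hirr : ActsIrred fun m : M => X m) {q : Q} (hq : ∀ m ∈ M, m * q = q * m) : q = 1 :=
  hf q (hirr.schur fun m => hX.commute_of_perfect hM hq m m.2)

section tensorInduction

universe u

variable {Q : Type u} [Group Q] {V : Type} [AddCommGroup V] [Module ℂ V] {X : Q → Module.End ℂ V}

/-- If the conjugates of `K` by `g ^ i`, `0 < i < m`, commute with the perfect group `K`, and the
sum of the conjugates of `X (g ^ m)` under `K` vanishes, then so does the trace of `X g`. -/
theorem trace_eq_zero_of_sum_conj_eq_zero (hX : IsProjRep X) {K : Subgroup Q} [Fintype K]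
    (hK : ⁅K, K⁆ = K) {g : Q} {m : ℕ} (hm : m ≠ 0)
    (hgm : g ^ m ∈ Subgroup.normalizer (K : Set Q))
    (hcomm : ∀ i, 0 < i → i < m → ∀ k ∈ K, g ^ i * k * (g ^ i)⁻¹ ∈
      Subgroup.centralizer (K : Set Q))
    (hsum : ∑ k : K, hX.conj k (X (g ^ m)) = 0) : LinearMap.trace ℂ V (X g) = 0 := by
  obtain ⟨d, hd, hpow⟩ := hX.pow_eq_smul g m
  -- Conjugation in the unit group agrees with conjugation in `Q` up to a scalar.
  have hconj : ∀ (i : ℕ) (k : Q), ∃ c : ℂ, c ≠ 0 ∧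
      ((hX.unit g ^ i * hX.unit k * (hX.unit g ^ i)⁻¹ : (Module.End ℂ V)ˣ) : Module.End ℂ V) =
        c • X (g ^ i * k * (g ^ i)⁻¹) := by
    intro i k
    induction i with
    | zero => exact ⟨1, one_ne_zero, by simp⟩
    | succ i ih =>
      obtain ⟨c, hc, e⟩ := ih
      obtain ⟨c', hc', e'⟩ := hX.conj_apply_self g (g ^ i * k * (g ^ i)⁻¹)
      refine ⟨c * c', mul_ne_zero hc hc', ?_⟩
      have h1 : hX.unit g ^ (i + 1) * hX.unit k * (hX.unit g ^ (i + 1))⁻¹ =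
          hX.unit g * (hX.unit g ^ i * hX.unit k * (hX.unit g ^ i)⁻¹) * (hX.unit g)⁻¹ := by
        rw [pow_succ' (hX.unit g)]
        group
      have h2 : g ^ (i + 1) * k * (g ^ (i + 1))⁻¹ = g * (g ^ i * k * (g ^ i)⁻¹) * g⁻¹ := by
        rw [pow_succ' g]
        group
      rw [h1, Units.val_mul, Units.val_mul, e, h2, mul_smul, ← e', hX.conj_apply, hX.unit_val,
        mul_smul_comm, smul_mul_assoc, mul_assoc]
  have key : ∀ k : K, LinearMap.trace ℂ V (X g) = LinearMap.trace ℂ V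
      (hX.conj k (X g ^ m) * (((hX.unit g ^ m)⁻¹ * hX.unit g : (Module.End ℂ V)ˣ) :
        Module.End ℂ V)) := by
    intro k
    obtain ⟨p, hp⟩ := exists_conj_eq_of_commute (hX.unit g) (hX.unit (k : Q)) hm (by
      intro i hi him
      obtain ⟨c, -, e⟩ := hconj i k
      obtain ⟨c', -, e'⟩ := hconj m k
      refine Units.ext ?_
      rw [Units.val_mul (hX.unit g ^ i * hX.unit k * (hX.unit g ^ i)⁻¹),
        Units.val_mul (hX.unit g ^ m * hX.unit k * (hX.unit g ^ m)⁻¹), e, e', smul_mul_smul_comm,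
        smul_mul_smul_comm, mul_comm c']
      congr 1
      exact hX.commute_of_perfect hK
        (fun l hl => Subgroup.mem_centralizer_iff.1 (hcomm i hi him k k.2) l hl) _
        ((Subgroup.mem_normalizer_iff.1 hgm k).1 k.2))
    have h1 := congrArg (fun u : (Module.End ℂ V)ˣ => LinearMap.trace ℂ V (u : Module.End ℂ V)) hp
    simp only [Units.val_mul, LinearMap.trace_conj] at h1
    rw [hX.unit_val] at h1
    rw [h1, hX.conj_apply, Units.val_mul, hX.unit_val, hX.unit_val, Units.val_pow_eq_pow_val,
      hX.unit_val]
    simp only [mul_assoc]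
  have h0 : ∑ k : K, hX.conj k (X g ^ m) = 0 := by
    rw [← smul_right_injective (Module.End ℂ V) hd |>.eq_iff, Finset.smul_sum, smul_zero, ← hsum]
    refine Finset.sum_congr rfl fun k _ => ?_
    rw [← map_smul, ← hpow]
  have h1 : (Fintype.card K : ℂ) * LinearMap.trace ℂ V (X g) = 0 := by
    rw [← nsmul_eq_mul, ← Finset.card_univ, ← Finset.sum_const, Finset.sum_congr rfl
      (fun k _ => key k), ← map_sum, ← Finset.sum_mul, h0, zero_mul, map_zero]
  exact (mul_eq_zero.1 h1).resolve_left (by exact_mod_cast Fintype.card_ne_zero)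

/-- A projective representation that is irreducible on the product of a perfect normal subgroup `K`
and its centralizer is a tensor product of projective representations, one irreducible on `K` and
scalar on the centralizer of `K`, the other irreducible on the centralizer. -/
theorem exists_isTensorDecomp_of_perfect [Finite Q] [FiniteDimensional ℂ V]
    (hX : IsProjRep X) (K : Subgroup Q) [K.Normal]
    (hK : ⁅K, K⁆ = K)
    (hirr : ActsIrred fun q : (K ⊔ Subgroup.centralizer (K : Set Q) : Subgroup Q) => X q) :
    ∃ (U : Submodule ℂ V) (Y : Type) (_ : AddCommGroup Y) (_ : Module ℂ Y)
      (_ : FiniteDimensional ℂ Y) (E : Y ⊗[ℂ] U ≃ₗ[ℂ] V) (b : Q → Module.End ℂ Y)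
      (a : Q → Module.End ℂ U), IsTensorDecomp X E b a ∧
      (∀ k : K, ∃ c : ℂ, c ≠ 0 ∧ b k = c • 1) ∧ (ActsIrred fun k : K => a k) ∧
      (∀ q ∈ Subgroup.centralizer (K : Set Q), ∃ c : ℂ, c ≠ 0 ∧ a q = c • 1) ∧
      ActsIrred fun q : Subgroup.centralizer (K : Set Q) => b q := by
  have hVn := hirr.nontrivial
  set C := Subgroup.centralizer (K : Set Q) with hC
  have hCX : ∀ q ∈ C, ∀ k : K, X q * X k = X k * X q := fun q hq k =>
    hX.commute_of_perfect hK (fun l hl => Subgroup.mem_centralizer_iff.1 hq l hl) k k.2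
  obtain ⟨U, hU, hUirr⟩ := exists_actsIrred_restrict fun k : K => X k
  have hW := isBiInvariant_isotypicSpan hU
  have hWtop : isotypicSpan (fun k : K => X k) U = ⊤ := by
    refine (hirr.eq_bot_or_eq_top _ fun q => ?_).resolve_left fun h => ?_
    · exact hX.invariant_of_mem_sup (fun k hk => hW.1 ⟨k, hk⟩) (fun q hq => hW.2 _ (hCX q hq)) q q.2
    · exact Submodule.nontrivial_iff_ne_bot.1 hUirr.nontrivial (le_bot_iff.1 (h ▸ le_isotypicSpan))
  obtain ⟨Y, i1, i2, i3, E, b, a, hdec, hb, ha⟩ :=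
    exists_isTensorDecomp hX K ((hX.subgroup K).restrict hU) hUirr (by
      rw [eq_top_iff, ← hWtop]
      refine iSup_le ?_
      rintro ⟨c, hc⟩ _ ⟨u, hu, rfl⟩
      refine (le_iSup₂ (f := fun (f : U →ₗ[ℂ] V) (_ : f ∈ homSpace
        (fun k : K => (X k).restrict (hU k)) (fun k : K => X k)) => LinearMap.range f)
        (c ∘ₗ U.subtype) ?_) ⟨⟨u, hu⟩, rfl⟩
      exact mem_homSpace.2 fun k u => LinearMap.congr_fun (hc k) u)
  have hUn := hUirr.nontrivial
  have haK : ActsIrred fun k : K => a k := by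
    refine hUirr.of_forall_invariant fun W hW k w hw => ?_
    obtain ⟨c, hc, e⟩ := ha k
    have h1 := W.smul_mem c⁻¹ (hW k w hw)
    rwa [e, LinearMap.smul_apply, inv_smul_smul₀ hc] at h1
  have hbQ := hdec.isProjRep_left hX
  have haQ := hdec.isProjRep_right hX
  refine ⟨U, Y, i1, i2, i3, E, b, a, hdec, hb, haK, fun q hq => ?_, ?_⟩
  · obtain ⟨c, e⟩ := haK.schur fun k => haQ.commute_of_perfect hK
      (fun l hl => Subgroup.mem_centralizer_iff.1 hq l hl) k k.2
    exact ⟨c, haQ.exists_ne_zero_smul_one e, e⟩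
  · refine (hdec.actsIrred_left hirr).of_forall_invariant fun W hW q => ?_
    refine hbQ.invariant_of_mem_sup (fun k hk w hw => ?_) (fun q hq => hW ⟨q, hq⟩) q q.2
    obtain ⟨c, -, e⟩ := hb ⟨k, hk⟩
    rw [e]
    exact W.smul_mem c hw

/-- Conjugation by `K` only affects the second factor, so the averaging argument for the irreducible
action of `K` on that factor applies. -/
theorem IsTensorDecomp.sum_conj_eq_zero {Y U : Type} [AddCommGroup Y] [Module ℂ Y]
    [AddCommGroup U] [Module ℂ U] [FiniteDimensional ℂ U] {E : Y ⊗[ℂ] U ≃ₗ[ℂ] V}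
    {b : Q → Module.End ℂ Y} {a : Q → Module.End ℂ U} (h : IsTensorDecomp X E b a)
    (hX : IsProjRep X) (ha : IsProjRep a) (K : Subgroup Q) [Fintype K]
    (hb : ∀ k : K, ∃ c : ℂ, c ≠ 0 ∧ b k = c • 1) (hirr : ActsIrred fun k : K => a k) {q : Q}
    (hq : LinearMap.trace ℂ U (a q) = 0) : ∑ k : K, hX.conj k (X q) = 0 := by
  have hmul : ∀ S S', E.conj (S * S') = E.conj S * E.conj S' := fun S S' => E.conj_comp S' S
  have h1 : ∀ k : K, hX.conj k (X q) =
      E.conj (TensorProduct.map (b q) ((ha.subgroup K).conj k (a q))) := by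
    intro k
    symm
    obtain ⟨c, -, e⟩ := hb k
    rw [hX.eq_conj_iff, h.eq_conj, h.eq_conj, ← hmul, ← hmul,
      ← TensorProduct.map_mul, ← TensorProduct.map_mul, (ha.subgroup K).conj_mul_self, e,
      mul_smul_comm, smul_mul_assoc, one_mul, mul_one]
  have h2 := (ha.subgroup K).avg_eq hirr (a q)
  rw [hq, mul_zero, zero_div, zero_smul, IsProjRep.avg] at h2
  simp_rw [h1]
  rw [← map_sum]
  have h3 : ∑ k : K, TensorProduct.map (b q) ((ha.subgroup K).conj k (a q)) =
      TensorProduct.map (b q) (∑ k : K, (ha.subgroup K).conj k (a q)) := by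
    rw [← TensorProduct.mapBilinear_apply, map_sum]
    rfl
  rw [h3, h2, TensorProduct.map_zero_right, map_zero]

/-- The case of a simple subgroup `K` that is not normal in `Q`: with respect to the normalizer of
`K`, the space is a tensor product of projective representations to which the inductive assumption
applies. -/
theorem orderOf_mul_finrank_dvd_of_not_normal [Finite Q] [FiniteDimensional ℂ V]
    (ih : ∀ n < Nat.card Q, OrderMulDegreeDvd.{u} n)
    (hX : IsProjRep X) (hf : IsProjRep.Faithful X) (M : Subgroup Q) [M.Normal]
    (hirr : ActsIrred fun m : M => X m) {g : Q} (hgen : M ⊔ Subgroup.zpowers g = ⊤)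
    (htr : LinearMap.trace ℂ V (X g) ≠ 0) (K : Subgroup Q) [IsSimpleGroup K]
    (hK : ∃ a ∈ K, ∃ b ∈ K, a * b ≠ b * a) (hKM : K ≤ M)
    (hMT : M ≤ Subgroup.normalizer (K : Set Q))
    (hncl : Subgroup.normalClosure (K : Set Q) = M)
    (hMKC : M ≤ K ⊔ Subgroup.centralizer (K : Set Q))
    (hcomm : ∀ q ∉ Subgroup.normalizer (K : Set Q), ∀ k ∈ K,
        q * k * q⁻¹ ∈ Subgroup.centralizer (K : Set Q))
    (hT : Subgroup.normalizer (K : Set Q) ≠ ⊤) :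
    orderOf g * finrank ℂ V ∣ Nat.card Q := by
  have hVn := hirr.nontrivial
  have hperf := commutator_eq_self_of_isSimpleGroup K hK
  have hMperf : ⁅M, M⁆ = M := by
    refine le_antisymm (Subgroup.commutator_le_right M M) ?_
    nth_rewrite 1 [← hncl]
    refine Subgroup.normalClosure_le_normal fun k hk => ?_
    rw [SetLike.mem_coe, ← hperf] at hk
    exact Subgroup.commutator_mono hKM hKM hk
  set T := Subgroup.normalizer (K : Set Q) with hTdef
  have hKT : K ≤ T := hKM.trans hMT
  -- `T` is normal: it contains `M`, and `Q / M` is cyclic.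
  have hTn : T.Normal := by
    rw [← Subgroup.normalizer_eq_top_iff, eq_top_iff, ← hgen]
    refine sup_le (hMT.trans Subgroup.le_normalizer) ?_
    rw [Subgroup.zpowers_le]
    refine Subgroup.mem_normalizer_fintype fun t ht => ?_
    have ht' : t ∈ M ⊔ Subgroup.zpowers g := hgen ▸ Subgroup.mem_top t
    obtain ⟨m, hm, z, hz, rfl⟩ := Subgroup.mem_sup_of_normal_left.1 ht'
    obtain ⟨j, rfl⟩ := Subgroup.mem_zpowers_iff.1 hz
    have h1 : g * (m * g ^ j) * g⁻¹ = (g * m * g⁻¹) * m⁻¹ * (m * g ^ j) := by group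
    rw [h1]
    exact T.mul_mem (T.mul_mem (hMT (Subgroup.Normal.conj_mem ‹_› m hm g))
      (T.inv_mem (hMT hm))) ht
  set s := orderOf (g : Q ⧸ T) with hs
  have hgs : g ^ s ∈ T := pow_orderOf_mk_mem T g
  have hs0 : s ≠ 0 := (orderOf_pos _).ne'
  have hcardQ : Nat.card Q = s * Nat.card T := by
    rw [← card_sup_zpowers, eq_top_iff.2 (hgen.ge.trans (sup_le_sup_right hMT _)),
      Subgroup.card_top]
  have hog : orderOf g = s * orderOf (g ^ s) := by
    have hdvd : s ∣ orderOf g := by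
      rw [hs, orderOf_mk_dvd_iff, pow_orderOf_eq_one]
      exact T.one_mem
    rw [orderOf_pow_of_dvd hs0 hdvd, Nat.mul_div_cancel' hdvd]
  have hTlt : Nat.card T < Nat.card Q := card_lt_of_ne_top hT
  -- `M` lies in the product of `K` and its centralizer, both contained in `T`.
  let K' := K.subgroupOf T
  have hK'n : K'.Normal := Subgroup.normal_in_normalizer
  let C' := Subgroup.centralizer (K' : Set T)
  have hXT := hX.subgroup T
  have hTirr : ActsIrred fun t : T => X t :=
    hirr.of_forall_invariant fun W hW m => hW ⟨m, hMT m.2⟩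
  have hMle : M ≤ (K' ⊔ C').map T.subtype := by
    refine hMKC.trans (sup_le (fun k hk => ?_) fun c hc => ?_)
    · exact ⟨⟨k, hKT hk⟩, (le_sup_left : K' ≤ K' ⊔ C') hk, rfl⟩
    · refine ⟨⟨c, Subgroup.centralizer_le_normalizer _ hc⟩, (le_sup_right : C' ≤ K' ⊔ C') ?_, rfl⟩
      exact Subgroup.mem_centralizer_iff.2 fun k hk =>
        Subtype.ext (Subgroup.mem_centralizer_iff.1 hc k hk)
  have hK'perf : ⁅K', K'⁆ = K' := by
    apply Subgroup.map_injective T.subtype_injective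
    rw [Subgroup.map_commutator, Subgroup.map_subgroupOf_eq_of_le hKT, hperf]
  have hirr' : ActsIrred fun q : (K' ⊔ C' : Subgroup T) => X (q : T) := by
    refine hirr.of_forall_invariant fun W hW m => ?_
    obtain ⟨t, ht, e⟩ := hMle m.2
    rw [← e]
    exact hW ⟨t, ht⟩
  obtain ⟨U, Y, _, _, _, E, b, a, hdec, hb, haK, haC, hbC⟩ :=
    exists_isTensorDecomp_of_perfect hXT K' hK'perf hirr'
  have hbT := hdec.isProjRep_left hXT
  have haT := hdec.isProjRep_right hXT
  have hbn := hbC.nontrivial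
  have htra : LinearMap.trace ℂ U (a ⟨g ^ s, hgs⟩) ≠ 0 := by
    intro h0
    have := Fintype.ofFinite K
    have := Fintype.ofFinite K'
    refine htr (trace_eq_zero_of_sum_conj_eq_zero hX hperf hs0 hgs (fun i hi his => ?_) ?_)
    · refine hcomm _ fun h => ?_
      exact (Nat.le_of_dvd hi ((orderOf_mk_dvd_iff T).2 h)).not_gt his
    · have h1 := hdec.sum_conj_eq_zero hXT haT K' hb haK h0
      rw [← h1]
      refine (Fintype.sum_equiv (Subgroup.subgroupOfEquivOfLe hKT).toEquiv _ _ fun k => ?_).symm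
      rw [hX.eq_conj_iff]
      exact hXT.conj_mul_self _ _
  have h1 := orderOf_mk_mul_finrank_dvd C' (ih _ ((Nat.le_of_dvd Nat.card_pos
    (Subgroup.card_quotient_dvd_card C')).trans_lt hTlt)) haT
    (haK.of_forall_invariant fun W hW k => hW k) (fun c hc => haC c hc) htra
  have h2 := ih _ ((Nat.le_of_dvd Nat.card_pos (Subgroup.card_subgroup_dvd_card C')).trans_lt hTlt)
    C' rfl Y _ (hbT.subgroup C') hbC 1 (hbT.subgroup C').trace_one_ne_zero
  rw [orderOf_one, one_mul] at h2
  -- A power of `g ^ s` that centralizes `K` centralizes all conjugates of `K`, hence `M`.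
  have h3 : orderOf (g ^ s) ∣ orderOf ((⟨g ^ s, hgs⟩ : T) : T ⧸ C') := by
    set j := orderOf ((⟨g ^ s, hgs⟩ : T) : T ⧸ C') with hj
    rw [orderOf_dvd_iff_pow_eq_one]
    have hjC : (⟨g ^ s, hgs⟩ : T) ^ j ∈ C' := pow_orderOf_mk_mem C' _
    refine eq_one_of_faithful_of_perfect hX hf hMperf hirr fun m hm => ?_
    have hle : M ≤ Subgroup.centralizer {(g ^ s) ^ j} := by
      nth_rewrite 1 [← hncl]
      rw [Subgroup.normalClosure, Subgroup.closure_le]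
      intro x hx
      obtain ⟨k, hk, hx⟩ := Group.mem_conjugatesOfSet_iff.1 hx
      obtain ⟨q, rfl⟩ := isConj_iff.1 hx
      have hq : q ∈ Subgroup.zpowers g ⊔ M := by
        rw [sup_comm, hgen]
        exact Subgroup.mem_top q
      obtain ⟨z, hz, m, hm, rfl⟩ := Subgroup.mem_sup_of_normal_right.1 hq
      obtain ⟨i, rfl⟩ := Subgroup.mem_zpowers_iff.1 hz
      have hk' := (Subgroup.mem_normalizer_iff.1 (hMT hm) k).1 hk
      have e1 : Commute ((g ^ s) ^ j) (m * k * m⁻¹) :=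
        (congrArg Subtype.val (Subgroup.mem_centralizer_iff.1 hjC ⟨_, hKT hk'⟩ hk')).symm
      have e2 : Commute ((g ^ s) ^ j) (g ^ i) :=
        ((Commute.refl g).zpow_right i).pow_left s |>.pow_left j
      have e3 : g ^ i * m * k * (g ^ i * m)⁻¹ = g ^ i * (m * k * m⁻¹) * (g ^ i)⁻¹ := by group
      rw [e3]
      refine Subgroup.mem_centralizer_iff.2 ?_
      rintro _ rfl
      exact (e2.mul_right e1).mul_right e2.inv_right
    exact (Subgroup.mem_centralizer_iff.1 (hle hm) _ rfl).symm
  have hdim : finrank ℂ V = finrank ℂ Y * finrank ℂ U := by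
    rw [← LinearEquiv.finrank_eq E, finrank_tensorProduct]
  rw [hog, hdim, hcardQ, Subgroup.card_eq_card_quotient_mul_card_subgroup C', mul_assoc,
    mul_comm (finrank ℂ Y), ← mul_assoc (orderOf (g ^ s))]
  exact Nat.mul_dvd_mul_left s (Nat.mul_dvd_mul ((Nat.mul_dvd_mul_right h3 _).trans h1) h2)

end tensorInduction

/-! ### The divisibility for all projective representations -/

section mainInduction

universe u

variable {Q : Type u} [Group Q] [Finite Q] {V : Type} [AddCommGroup V] [Module ℂ V]
  [FiniteDimensional ℂ V] {X : Q → Module.End ℂ V}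

/-- The case of a cyclic extension of a minimal normal subgroup that acts irreducibly. -/
theorem orderOf_mul_finrank_dvd_of_minimal_normal (hconj : NearlySimpleConjecture)
    (ih : ∀ n < Nat.card Q, OrderMulDegreeDvd.{u} n) (hX : IsProjRep X) (M : Subgroup Q) [M.Normal]
    (hM : M ≠ ⊥) (hmin : ∀ L ≤ M, L.Normal → L ≠ ⊥ → L = M) (hirr : ActsIrred fun m : M => X m)
    {g : Q} (hgen : M ⊔ Subgroup.zpowers g = ⊤) (htr : LinearMap.trace ℂ V (X g) ≠ 0) :
    orderOf g * finrank ℂ V ∣ Nat.card Q := by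
  have hirrQ : ActsIrred X := hirr.of_forall_invariant fun W hW m => hW m
  by_cases hker : hX.scalarKernel = ⊥
  swap
  · exact orderOf_mul_finrank_dvd_of_scalarKernel_ne_bot ih hX hirrQ hker htr
  have := hirr.nontrivial
  have hf := hX.faithful_of_scalarKernel_eq_bot hker
  by_cases hab : ∀ a ∈ M, ∀ b ∈ M, a * b = b * a
  · obtain ⟨hcard, hexp⟩ := card_eq_sq_of_abelian hX hf M hirr hab
    have h1 := orderOf_dvd_orderOf_mk_mul M g (hexp _ (pow_orderOf_mk_mem M g))
    have h2 := card_sup_zpowers M g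
    rw [hgen, Subgroup.card_top, hcard, ← mul_assoc] at h2
    rw [h2]
    exact Nat.mul_dvd_mul_right h1 _
  push Not at hab
  obtain ⟨K, hKs, hKne, hKM, hMT, hncl, hMKC, hcomm⟩ :=
    exists_simple_of_minimal_normal M hM hmin hab
  by_cases hT : Subgroup.normalizer (K : Set Q) = ⊤
  · have hKn : K.Normal := Subgroup.normalizer_eq_top_iff.1 hT
    obtain rfl : K = M := hmin K hKM hKn fun h => by
      obtain ⟨a, ha, b, hb, hab⟩ := hKne
      rw [h, Subgroup.mem_bot] at ha hb
      exact hab (by rw [ha, hb])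
    exact hconj.orderOf_mul_finrank_dvd hX hf K hKne hirr hgen htr
  · exact orderOf_mul_finrank_dvd_of_not_normal ih hX hf M hirr hgen htr K hKne hKM hMT hncl hMKC
      hcomm hT

/-- The induction on the order of the group, by Clifford theory for a minimal normal subgroup. -/
theorem NearlySimpleConjecture.orderMulDegreeDvd (hconj : NearlySimpleConjecture) (n : ℕ) :
    OrderMulDegreeDvd.{u} n := by
  induction n using Nat.strong_induction_on with
  | _ n ih =>
  rintro Q _ _ rfl V _ _ _ X hX hirr g htr
  have := hirr.nontrivial
  by_cases hker : hX.scalarKernel = ⊥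
  swap
  · exact orderOf_mul_finrank_dvd_of_scalarKernel_ne_bot ih hX hirr hker htr
  by_cases hQ : (⊤ : Subgroup Q) = ⊥
  · have hQ1 : ∀ q : Q, q = 1 := fun q => by
      have := Subgroup.mem_top q
      rwa [hQ, Subgroup.mem_bot] at this
    have h1 : finrank ℂ V = 1 := hirr.finrank_eq_one fun q => by
      obtain ⟨c, -, e⟩ := hX.one
      exact ⟨c, by rw [hQ1 q, e]⟩
    rw [h1, hQ1 g, orderOf_one]
    exact one_dvd _
  obtain ⟨M, hMn, hM0, hmin⟩ := exists_minimal_subgroup (fun L : Subgroup Q => L.Normal)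
    (H := ⊤) inferInstance hQ
  obtain ⟨U, hU, hUirr⟩ := exists_actsIrred_restrict fun m : M => X m
  obtain ⟨T, hMT, Y, _, _, _, b, a, hb, ha, hbirr, hbM, haM, hdim, htrT⟩ :=
    hX.clifford hirr M hU hUirr
  obtain ⟨x, hg', htrb, htra⟩ := htrT g htr
  have hog : orderOf (x⁻¹ * g * x) = orderOf g := by
    have := orderOf_injective (MulAut.conj x⁻¹).toMonoidHom (MulAut.conj x⁻¹).injective g
    simpa [MulAut.conj_apply] using this
  rw [← hog]
  set g' := x⁻¹ * g * x
  let M' := M.subgroupOf T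
  have hcardM' : Nat.card M' = Nat.card M :=
    Nat.card_congr (Subgroup.subgroupOfEquivOfLe hMT).toEquiv
  have haMirr : ActsIrred fun m : M => a ⟨m, hMT m.2⟩ := by
    refine hUirr.of_forall_invariant fun W hW m w hw => ?_
    obtain ⟨c, hc, e⟩ := haM m
    have h1 := W.smul_mem c⁻¹ (hW m w hw)
    rwa [e, LinearMap.smul_apply, inv_smul_smul₀ hc] at h1
  -- The factor `b` is a projective representation of `T / M`.
  have hM'0 : M' ≠ ⊥ := fun h => hM0 (by
    rw [← Subgroup.card_eq_one, ← hcardM', h, Subgroup.card_bot])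
  have hlt : Nat.card (T ⧸ M') < Nat.card Q :=
    (card_quotient_lt_of_ne_bot hM'0).trans_le (Subgroup.card_le_card_group T)
  have h1 := orderOf_mk_mul_finrank_dvd M' (ih _ hlt) hb hbirr (fun m hm => hbM ⟨m, hm⟩) htrb
  have h2 : orderOf (g' : Q ⧸ M) ∣ orderOf ((⟨g', hg'⟩ : T) : T ⧸ M') := by
    rw [orderOf_mk_dvd_iff]
    exact pow_orderOf_mk_mem M' _
  -- The factor `a` is irreducible on the cyclic extension `⟨M, g'⟩` of `M`.
  have h3 : orderOf g' * finrank ℂ U ∣ orderOf (g' : Q ⧸ M) * Nat.card M := by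
    rw [← card_sup_zpowers]
    set H := M ⊔ Subgroup.zpowers g' with hH
    have hHT : H ≤ T := sup_le hMT (Subgroup.zpowers_le.2 hg')
    by_cases hHtop : H = ⊤
    · have hTtop : ∀ q : Q, q ∈ T := fun q => hHT (hHtop ▸ Subgroup.mem_top q)
      rw [hHtop, Subgroup.card_top]
      exact orderOf_mul_finrank_dvd_of_minimal_normal hconj ih
        (ha.comp ((MonoidHom.id Q).codRestrict T hTtop)) M hM0 hmin haMirr hHtop htra
    · have hgH : g' ∈ H := (le_sup_right : _ ≤ H) (Subgroup.mem_zpowers g')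
      have h4 := ih _ (card_lt_of_ne_top hHtop) H rfl U _ (ha.comp (Subgroup.inclusion hHT))
        (haMirr.of_forall_invariant fun W hW m => hW ⟨m, (le_sup_left : M ≤ H) m.2⟩) ⟨g', hgH⟩ htra
      rwa [Subgroup.orderOf_mk] at h4
  rw [hdim, ← Subgroup.index_mul_card T, Subgroup.card_eq_card_quotient_mul_card_subgroup M',
    hcardM', mul_left_comm]
  refine Nat.mul_dvd_mul_left _ ?_
  rw [mul_left_comm]
  refine (Nat.mul_dvd_mul_left _ h3).trans ?_
  rw [← mul_assoc]
  refine Nat.mul_dvd_mul_right ?_ _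
  rw [mul_comm]
  exact (Nat.mul_dvd_mul_right h2 _).trans h1

end mainInduction

/-! ### Characters lying over a character of a normal subgroup -/

/-- An irreducible constituent of a character is afforded by a subrepresentation. -/
theorem exists_injective_of_charInner_ne_zero {G V W : Type*} [Group G] [Finite G]
    [AddCommGroup V] [Module ℂ V] [FiniteDimensional ℂ V] [AddCommGroup W] [Module ℂ W]
    [FiniteDimensional ℂ W] (ρ : Representation ℂ G V) (σ : Representation ℂ G W)
    (hσ : σ.IsIrreducible) (h : charInner ρ.character σ.character ≠ 0) :
    ∃ f : W →ₗ[ℂ] V, Function.Injective f ∧ ∀ g w, f (σ g w) = ρ g (f w) := by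
  have := Fintype.ofFinite G
  have hcard : (Nat.card G : ℂ) ≠ 0 := by exact_mod_cast Nat.card_pos.ne'
  have : Invertible (Nat.card G : ℂ) := invertibleOfNonzero hcard
  have h1 : ∀ g, (starRingEnd ℂ) (σ.character g) = σ.character g⁻¹ := fun g =>
    conj_trace_of_pow_eq_one (n := Nat.card G) Nat.card_pos.ne'
      (by rw [← map_pow, pow_card_eq_one', map_one]) (by rw [← map_mul, inv_mul_cancel, map_one])
  rw [charInner, finsum_eq_sum_of_fintype] at h
  simp_rw [h1] at h
  rw [Representation.card_inv_mul_sum_char_mul_char_eq_finrank] at h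
  have h2 : Nontrivial (σ.IntertwiningMap ρ) := by
    by_contra hn
    rw [not_nontrivial_iff_subsingleton] at hn
    exact h (by rw [finrank_zero_of_subsingleton, Nat.cast_zero])
  obtain ⟨f, hf⟩ := exists_ne (0 : σ.IntertwiningMap ρ)
  exact ⟨f.toLinearMap, (Representation.IsIrreducible.injective_or_eq_zero f).resolve_right hf,
    fun g w => LinearMap.congr_fun (f.isIntertwining' g) w⟩

theorem theorem2p2 (hconj : NearlySimpleConjecture)
    {G : Type*} [Group G] [Finite G] (N : Subgroup G) [N.Normal]
    (θ : N → ℂ) (hθ : IsIrrChar θ) (χ : G → ℂ) (hχ : IsIrrCharOver θ χ)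
    (g : G) (hg : ∃ n ∈ N, χ (g * n) ≠ 0) :
    ∃ k : ℤ, (N.index : ℂ) * θ 1 / χ 1 = (orderOf (g : G ⧸ N) : ℂ) * k := by
  obtain ⟨e, σ, hσ, rfl⟩ := hθ
  obtain ⟨⟨d, ρ, hρ, rfl⟩, hinner⟩ := hχ
  obtain ⟨n, hn, htr⟩ := hg
  obtain ⟨f, hfinj, hf⟩ := exists_injective_of_charInner_ne_zero (ρ.comp N.subtype) σ hσ hinner
  -- The simple `N`-subspace `U` affords the character `θ`.
  let U := LinearMap.range f
  have hU : ∀ m : N, ∀ u ∈ U, ρ m u ∈ U := by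
    rintro m _ ⟨w, rfl⟩
    exact ⟨σ m w, hf m w⟩
  have hUirr : ActsIrred fun m : N => (ρ m).restrict (hU m) := by
    have hW := hσ.actsIrred.nontrivial
    refine ⟨(LinearEquiv.ofInjective f hfinj).symm.toEquiv.nontrivial, fun W hW => ?_⟩
    have hr : Function.Surjective f.rangeRestrict := f.surjective_rangeRestrict
    rw [← Submodule.map_comap_eq_of_surjective hr W]
    rcases hσ.actsIrred.eq_bot_or_eq_top (W.comap f.rangeRestrict) fun m w hw => by
        have h1 := hW m _ hw
        rw [Submodule.mem_comap]
        convert h1 using 1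
        exact Subtype.ext (hf m w) with h | h
    · exact Or.inl (by rw [h, Submodule.map_bot])
    · exact Or.inr (by rw [h, Submodule.map_top, LinearMap.range_eq_top.2 hr])
  obtain ⟨T, hNT, Y, _, _, _, b, a, hb, -, hbirr, hbN, -, hdim, htrT⟩ :=
    ρ.isProjRep.clifford hρ.actsIrred N hU hUirr
  obtain ⟨x, hx, htrb, -⟩ := htrT (g * n) htr
  let N' := N.subgroupOf T
  have h1 := orderOf_mk_mul_finrank_dvd N' (hconj.orderMulDegreeDvd _) hb hbirr
    (fun m hm => hbN ⟨m, hm⟩) htrb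
  have h2 : orderOf (g : G ⧸ N) ∣ orderOf ((⟨_, hx⟩ : T) : T ⧸ N') := by
    have h3 : (x⁻¹ * (g * n) * x) ^ orderOf ((⟨_, hx⟩ : T) : T ⧸ N') ∈ N :=
      pow_orderOf_mk_mem N' ⟨_, hx⟩
    have h4 : ((x⁻¹ * (g * n) * x : G) : G ⧸ N) = MulAut.conj (x : G ⧸ N)⁻¹ (g : G ⧸ N) := by
      rw [MulAut.conj_apply, QuotientGroup.mk_mul, QuotientGroup.mk_mul, QuotientGroup.mk_mul,
        (QuotientGroup.eq_one_iff n).2 hn, mul_one, QuotientGroup.mk_inv, inv_inv]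
    rwa [← orderOf_mk_dvd_iff, h4, MulEquiv.orderOf_eq] at h3
  have hindex : N.index = Nat.card (T ⧸ N') * T.index := (Subgroup.relIndex_mul_index hNT).symm
  obtain ⟨k, hk⟩ := (Nat.mul_dvd_mul_right h2 _).trans h1
  have hθ1 : σ.character 1 = e := by
    rw [Representation.char_one, finrank_fin_fun]
  have hχ1 : ρ.character 1 = T.index * (finrank ℂ Y * e) := by
    rw [Representation.char_one, hdim, LinearMap.finrank_range_of_inj hfinj, finrank_fin_fun]
    push_cast
    rfl
  have hT0 : (T.index : ℂ) ≠ 0 := by exact_mod_cast Subgroup.index_ne_zero_of_finite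
  have hY0 : (finrank ℂ Y : ℂ) ≠ 0 := by
    have := hbirr.nontrivial
    exact_mod_cast (finrank_pos (R := ℂ) (M := Y)).ne'
  have he0 : (e : ℂ) ≠ 0 := by
    have := hσ.actsIrred.nontrivial
    have h3 := (finrank_pos (R := ℂ) (M := Fin e → ℂ)).ne'
    rw [finrank_fin_fun] at h3
    exact_mod_cast h3
  refine ⟨k, ?_⟩
  rw [hθ1, hχ1, hindex, hk, div_eq_iff (mul_ne_zero hT0 (mul_ne_zero hY0 he0))]
  push_cast
  ring
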